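/- **Theorem 3.1.** Let $(\Omega,\mathcal F,\mathbb P)$ be a probability space, let $\mathcal U$ and $X$ be real separable Hilbert spaces, and let $\dot W=\{\dot W(h),\,h\in\mathcal U\}$ be a zero-mean Gaussian family on $\Omega$ with $\mathbb E\big(\dot W(h_1)\dot W(h_2)\big)=(h_1,h_2)_{\mathcal U}$ such that $\mathcal F$ is generated by $\dot W$ up to $\mathbb P$-null sets. Let $\{\mathfrak u_k\}$ be an orthonormal basis of $\mathcal U$. Let $\mathcal J$ be the set of multi-indices $\alpha=(\alpha_k)$ of non-negative integers with $|\alpha|=\sum_k\alpha_k<\infty$, and put $$\xi_\alpha=\prod_k\frac{H_{\alpha_k}(\dot W(\mathfrak u_k))}{\sqrt{\alpha_k!}},\qquad H_n(x)=(-1)^ne^{x^2/2}\frac{d^n}{dx^n}e^{-x^2/2}.$$ Let $Q=\{q_k\}$ be a sequence with $q_k\ge 1$ for all $k$, let $r\in\mathbb R$, and write $q^{s\alpha}=\prod_kq_k^{s\alpha_k}$. On $X\otimes\mathcal U^{\otimes n}$ let $\Lambda_Q^r$ be the self-adjoint diagonal operator with $$\Lambda_Q^r(x\otimes\mathfrak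 u_{k_1}\otimes\cdots\otimes\mathfrak u_{k_n})=q_{k_1}^r\cdots q_{k_n}^r\;x\otimes\mathfrak u_{k_1}\otimes\cdots\otimes\mathfrak u_{k_n}.$$ Let $\boldsymbol\delta$ be the Skorokhod integral, that is, the adjoint of the Malliavin derivative, and let $\boldsymbol\delta^{\hat\otimes k}$ be its $k$-fold iteration. The space $(\mathcal L)_{Q,r}(X)$ is the closure (completion) of the set of random elements $$\eta=\eta_0+\sum_{k=1}^N\frac1{k!}\,\boldsymbol\delta^{\hat\otimes k}(\eta_k),$$ where $\eta_0\in X$ and each $\eta_k$ is a deterministic element of $X\otimes\mathcal U^{\hat\otimes k}$ (symmetric tensors) in the domain of $\Lambda_Q^r$, with respect to the norm $$\|\eta\|_{Q,r;X}^2=\|\eta_0\|_X^2+\sum_{k=1}^N\frac1{(k!)^2}\,\|\Lambda_Q^r\eta_k\|^2_{X\otimes\mathcal U^{\otimes k}}.$$ An element of $(\mathcal L)_{Q,r}(X)$ is given by the formal series $\sum_\alpha\eta_\alpha\xi_\alpha$, $\eta_\alpha\in X$, if it is the limit in $(\mathcal L)_{Q,r}(X)$ of a sequence of such random elements $g_m$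 with $\mathbb E(g_m\xi_\alpha)\to\eta_\alpha$ for every $\alpha$. Then, for every family $(\eta_\alpha)_{\alpha\in\mathcal J}$ in $X$, the formal series $\eta=\sum_{\alpha\in\mathcal J}\eta_\alpha\xi_\alpha$ is an element of $(\mathcal L)_{Q,r}(X)$ if and only if $$\sum_{\alpha\in\mathcal J}\frac{1}{|\alpha|!}\,q^{2r\alpha}\,\|\eta_\alpha\|_X^2<\infty,$$ and in that case this sum equals $\|\eta\|_{Q,r;X}^2$. -/

import Mathlib

open MeasureTheory Filter Topology

open scoped ENNReal

noncomputable section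

namespace GaussianChaos

variable {Ω : Type*} [MeasurableSpace Ω]
variable {U : Type*} [NormedAddCommGroup U] [InnerProductSpace ℝ U]
variable {X : Type*} [NormedAddCommGroup X] [InnerProductSpace ℝ X]
variable {ι : Type*}

/-- `W` is a zero-mean Gaussian family on `U` with `E (W h₁ * W h₂) = (h₁, h₂)_U`. -/
structure IsWhiteNoise (W : U → Ω → ℝ) (P : Measure Ω) : Prop where
  measurable : ∀ h, Measurable (W h)
  gaussian : ProbabilityTheory.IsGaussianProcess W P
  mean : ∀ h, ∫ ω, W h ω ∂P = 0
  cov : ∀ h₁ h₂, ∫ ω, W h₁ ω * W h₂ ω ∂P = inner ℝ h₁ h₂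

/-- The σ-algebra of `Ω` is generated by the random variables `W h`, up to `P`-null sets. -/
def GeneratesMod (W : U → Ω → ℝ) (P : Measure Ω) : Prop :=
  ∀ A : Set Ω, MeasurableSet A → ∃ B : Set Ω,
    MeasurableSet[⨆ h, (borel ℝ).comap (W h)] B ∧ A =ᵐ[P] B

/-! ### Multi-indices and the Cameron-Martin basis

Multi-indices are `α : ι →₀ ℕ`, with `|α| = α.degree`. -/

/-- `q^{s α} = ∏ₖ qₖ^{s αₖ}`. -/
def qPow (q : ι → ℝ) (s : ℝ) (α : ι →₀ ℕ) : ℝ := α.prod fun k n => q k ^ (s * (n : ℝ))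

/-- `ξ_α = ∏ₖ H_{αₖ}(W(uₖ)) / √(αₖ!)`, where `Hₙ` is Mathlib's (probabilists') Hermite polynomial
`Hₙ(x) = (-1)ⁿ e^{x²/2} (dⁿ/dxⁿ) e^{-x²/2}`. -/
def xi (u : HilbertBasis ι ℝ U) (W : U → Ω → ℝ) (α : ι →₀ ℕ) (ω : Ω) : ℝ :=
  α.prod fun k n => Polynomial.aeval (W (u k) ω) (Polynomial.hermite n) / √(n.factorial : ℝ)

/-! ### Hilbert tensor powers -/

/-- The Hilbert space tensor product `X ⊗ U^{⊗ n}`, realized as `ℓ²` through a fixed orthonormal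
basis `(uₖ)` of `U`: the entry `f (k₁, …, kₙ) ∈ X` is the coefficient of
`u_{k₁} ⊗ ⋯ ⊗ u_{kₙ}` in `f`. For `n = 0` this is `X`. -/
abbrev Tensor (ι : Type*) (X : Type*) [NormedAddCommGroup X] (n : ℕ) : Type _ :=
  lp (fun _ : Fin n → ι => X) 2

/-- `f` belongs to the symmetric tensors `X ⊗ U^{⊗̂ n}`. -/
def IsSymm {n : ℕ} (f : Tensor ι X n) : Prop :=
  ∀ (σ : Equiv.Perm (Fin n)) (i : Fin n → ι), f (i ∘ σ) = f i

/-- The diagonal operator `Λ_Q^r` on `X ⊗ U^{⊗ n}`, with its natural (maximal) domain: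
`Λ_Q^r (x ⊗ u_{k₁} ⊗ ⋯ ⊗ u_{kₙ}) = q_{k₁}^r ⋯ q_{kₙ}^r (x ⊗ u_{k₁} ⊗ ⋯ ⊗ u_{kₙ})`. -/
def lambdaQ (X : Type*) [NormedAddCommGroup X] [InnerProductSpace ℝ X]
    (q : ι → ℝ) (r : ℝ) (n : ℕ) : Tensor ι X n →ₗ.[ℝ] Tensor ι X n where
  domain :=
    { carrier := {f | Memℓp (fun i : Fin n → ι => (∏ j, q (i j) ^ r) • f i) 2}
      add_mem' := by
        intro f g hf hg
        have h := Memℓp.add hf hg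
        simpa only [Set.mem_ofPred_eq, lp.coeFn_add, Pi.add_apply, smul_add, Pi.add_def] using h
      zero_mem' := by
        simpa [Pi.zero_def] using (zero_memℓp : Memℓp (0 : (Fin n → ι) → X) 2)
      smul_mem' := by
        intro c f hf
        have h := Memℓp.const_smul hf c
        simpa only [Set.mem_ofPred_eq, lp.coeFn_smul, Pi.smul_apply, smul_comm _ c, Pi.smul_def]
          using h }
  toFun :=
    { toFun := fun f => ⟨fun i => (∏ j, q (i j) ^ r) • (f : Tensor ι X n) i, f.2⟩
      map_add' := by
        intro f g
        ext i
        rw [lp.coeFn_add]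
        simp only [Submodule.coe_add, lp.coeFn_add, Pi.add_apply, smul_add]
      map_smul' := by
        intro c f
        ext i
        simp [smul_comm _ c] }

/-! ### Malliavin derivative and Skorokhod integral -/

/-- The Malliavin derivative on smooth cylindrical random variables, as a set of pairs `(φ, D φ)`:
`φ = F(W(h₁), …, W(h_N))`, `D φ = ∑ᵢ ∂ᵢF(W(h₁), …, W(h_N)) hᵢ`, with `F` smooth and of polynomial
growth together with all its derivatives. -/
def cylinderGraph (P : Measure Ω) (W : U → Ω → ℝ) : Set (Lp ℝ 2 P × Lp U 2 P) :=
  {p | ∃ (N : ℕ) (F : (Fin N → ℝ) → ℝ) (h : Fin N → U), F.HasTemperateGrowth ∧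
    (p.1 =ᵐ[P] fun ω => F fun i => W (h i) ω) ∧
    (p.2 =ᵐ[P] fun ω => ∑ i, fderiv ℝ F (fun j => W (h j) ω) (Pi.single i 1) • h i)}

/-- The graph of the (closed) Malliavin derivative `D` on `L₂(Ω)`; its domain is `𝔻^{1,2}`. -/
def malliavinGraph (P : Measure Ω) (W : U → Ω → ℝ) : Set (Lp ℝ 2 P × Lp U 2 P) :=
  closure (cylinderGraph P W)

/-- `g = δ(f)` for the Skorokhod integral `δ`, the adjoint of `D`, taking `Y ⊗ U`-valued random
elements to `Y`-valued ones, where `Y = X ⊗ U^{⊗ n}`: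
`E(φ g) = E (f, D φ)_U` for all `φ` in the domain of `D`. The identity in `Y` is written entrywise,
and `(f, v)_U = ∑ₖ (uₖ, v)_U fₖ`, where `fₖ` is the coefficient of `uₖ` in `f`,
so that `E (f, D φ)_U = ∑ₖ E ((uₖ, D φ)_U fₖ)` (absolutely convergent). -/
def IsSkorokhod (P : Measure Ω) (W : U → Ω → ℝ) (u : HilbertBasis ι ℝ U) {n : ℕ}
    (f : Lp (Tensor ι X (n + 1)) 2 P) (g : Lp (Tensor ι X n) 2 P) : Prop :=
  ∀ p ∈ malliavinGraph P W, ∀ i : Fin n → ι,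
    HasSum (fun k => ∫ ω, inner ℝ (u k) (p.2 ω) • f ω (Fin.snoc i k) ∂P)
      (∫ ω, p.1 ω • g ω i ∂P)

/-- `g = δⁿ(f)`, the `n`-fold iteration of `δ` applied to `f ∈ L₂(Ω; X ⊗ U^{⊗ n})`. -/
def IsSkorokhodIter (P : Measure Ω) (W : U → Ω → ℝ) (u : HilbertBasis ι ℝ U) :
    (n : ℕ) → Lp (Tensor ι X n) 2 P → Lp X 2 P → Prop
  | 0, f, g => g =ᵐ[P] fun ω => f ω Fin.elim0
  | n + 1, f, g => ∃ f' : Lp (Tensor ι X n) 2 P,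
      IsSkorokhod P W u f f' ∧ IsSkorokhodIter P W u n f' g

section Linearity

variable {P : Measure Ω} {W : U → Ω → ℝ} {u : HilbertBasis ι ℝ U}

lemma integrable_smul_entry {n : ℕ} {φ : Ω → ℝ} (hφ : MemLp φ 2 P) (f : Lp (Tensor ι X n) 2 P)
    (i : Fin n → ι) : Integrable (fun ω => φ ω • f ω i) P := by
  have h : MemLp (fun ω => f ω i) 2 P := by
    have := (lp.evalCLM ℝ (fun _ : Fin n → ι => X) 2 i).comp_memLp' (Lp.memLp f)
    exact this
  exact memLp_one_iff_integrable.1 (h.smul hφ)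

lemma memLp_inner (v : U) (y : Lp U 2 P) : MemLp (fun ω => inner ℝ v (y ω)) 2 P :=
  (innerSL ℝ v).comp_memLp' (Lp.memLp y)

lemma IsSkorokhod.add {n : ℕ} {f₁ f₂ : Lp (Tensor ι X (n + 1)) 2 P}
    {g₁ g₂ : Lp (Tensor ι X n) 2 P} (h₁ : IsSkorokhod P W u f₁ g₁)
    (h₂ : IsSkorokhod P W u f₂ g₂) : IsSkorokhod P W u (f₁ + f₂) (g₁ + g₂) := by
  intro p hp i
  have h := (h₁ p hp i).add (h₂ p hp i)
  rw [← integral_add (integrable_smul_entry (Lp.memLp _) _ _)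
    (integrable_smul_entry (Lp.memLp _) _ _)] at h
  convert h using 1
  · funext k
    rw [← integral_add (integrable_smul_entry (memLp_inner _ _) _ _)
      (integrable_smul_entry (memLp_inner _ _) _ _)]
    refine integral_congr_ae ?_
    filter_upwards [Lp.coeFn_add f₁ f₂] with ω hω
    rw [hω]
    simp only [Pi.add_apply, lp.coeFn_add, smul_add]
  · refine integral_congr_ae ?_
    filter_upwards [Lp.coeFn_add g₁ g₂] with ω hω
    rw [hω]
    simp only [Pi.add_apply, lp.coeFn_add, smul_add]

lemma IsSkorokhod.smul {n : ℕ} {f : Lp (Tensor ι X (n + 1)) 2 P}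
    {g : Lp (Tensor ι X n) 2 P} (c : ℝ) (h : IsSkorokhod P W u f g) :
    IsSkorokhod P W u (c • f) (c • g) := by
  intro p hp i
  have h := (h p hp i).const_smul c
  rw [← integral_smul] at h
  convert h using 1
  · funext k
    rw [← integral_smul]
    refine integral_congr_ae ?_
    filter_upwards [Lp.coeFn_smul c f] with ω hω
    rw [hω]
    simp only [Pi.smul_apply, lp.coeFn_smul, smul_comm _ c]
  · refine integral_congr_ae ?_
    filter_upwards [Lp.coeFn_smul c g] with ω hω
    rw [hω]
    simp only [Pi.smul_apply, lp.coeFn_smul, smul_comm _ c]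

lemma IsSkorokhodIter.add {n : ℕ} {f₁ f₂ : Lp (Tensor ι X n) 2 P} {g₁ g₂ : Lp X 2 P}
    (h₁ : IsSkorokhodIter P W u n f₁ g₁) (h₂ : IsSkorokhodIter P W u n f₂ g₂) :
    IsSkorokhodIter P W u n (f₁ + f₂) (g₁ + g₂) := by
  induction n with
  | zero =>
    simp only [IsSkorokhodIter] at *
    filter_upwards [h₁, h₂, Lp.coeFn_add f₁ f₂, Lp.coeFn_add g₁ g₂] with ω a b c d
    rw [c, d, Pi.add_apply, Pi.add_apply, lp.coeFn_add, Pi.add_apply, a, b]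
  | succ n ih =>
    obtain ⟨a, ha, ha'⟩ := h₁
    obtain ⟨b, hb, hb'⟩ := h₂
    exact ⟨a + b, ha.add hb, ih ha' hb'⟩

lemma IsSkorokhodIter.smul {n : ℕ} {f : Lp (Tensor ι X n) 2 P} {g : Lp X 2 P} (c : ℝ)
    (h : IsSkorokhodIter P W u n f g) : IsSkorokhodIter P W u n (c • f) (c • g) := by
  induction n generalizing g with
  | zero =>
    simp only [IsSkorokhodIter] at *
    filter_upwards [h, Lp.coeFn_smul c f, Lp.coeFn_smul c g] with ω a b d
    rw [b, d, Pi.smul_apply, Pi.smul_apply, lp.coeFn_smul, Pi.smul_apply, a]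
  | succ n ih =>
    obtain ⟨a, ha, ha'⟩ := h
    exact ⟨c • a, ha.smul c, ih ha'⟩

lemma IsSkorokhodIter.zero (n : ℕ) : IsSkorokhodIter P W u n (0 : Lp (Tensor ι X n) 2 P) 0 := by
  induction n with
  | zero =>
    simp only [IsSkorokhodIter]
    filter_upwards [Lp.coeFn_zero (Tensor ι X 0) 2 P, Lp.coeFn_zero X 2 P] with ω a b
    rw [a, b, Pi.zero_apply, Pi.zero_apply, lp.coeFn_zero, Pi.zero_apply]
  | succ n ih =>
    refine ⟨0, ?_, ih⟩
    intro p _ i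
    have h0 : ∫ ω, p.1 ω • (0 : Lp (Tensor ι X n) 2 P) ω i ∂P = 0 := by
      refine integral_eq_zero_of_ae ?_
      filter_upwards [Lp.coeFn_zero (Tensor ι X n) 2 P] with ω a
      rw [a, Pi.zero_apply, lp.coeFn_zero, Pi.zero_apply, smul_zero, Pi.zero_apply]
    rw [h0]
    convert hasSum_zero with k
    refine integral_eq_zero_of_ae ?_
    filter_upwards [Lp.coeFn_zero (Tensor ι X (n + 1)) 2 P] with ω a
    rw [a, Pi.zero_apply, lp.coeFn_zero, Pi.zero_apply, smul_zero, Pi.zero_apply]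

end Linearity

/-! ### The weighted spaces -/

/-- The pairs `(g, (η₀, η₁, …))` consisting of a random element
`g = η₀ + ∑_{k = 1}^N (1 / k!) δᵏ(η_k)` and of its kernels: `η_k ∈ X ⊗ U^{⊗̂ k}`, each in the domain
of `Λ_Q^r`, only finitely many non-zero. -/
def simpleSubmodule (P : Measure Ω) (W : U → Ω → ℝ) (u : HilbertBasis ι ℝ U) (q : ι → ℝ) (r : ℝ)
    (X : Type*) [NormedAddCommGroup X] [InnerProductSpace ℝ X] [IsFiniteMeasure P] :
    Submodule ℝ (Lp X 2 P × Π₀ k, Tensor ι X k) where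
  carrier := {p | (∀ k, IsSymm (p.2 k)) ∧ (∀ k, p.2 k ∈ (lambdaQ X q r k).domain) ∧
    ∃ s : ℕ →₀ Lp X 2 P, (∀ k, IsSkorokhodIter P W u k (Lp.const 2 P (p.2 k)) (s k)) ∧
      p.1 = s.sum fun k g => (1 / (k.factorial : ℝ)) • g}
  add_mem' := by
    rintro p p' ⟨h1, h2, s, h3, h4⟩ ⟨h1', h2', s', h3', h4'⟩
    refine ⟨fun k σ i => ?_, fun k => ?_, s + s', fun k => ?_, ?_⟩
    · rw [Prod.snd_add, DFinsupp.add_apply, lp.coeFn_add, Pi.add_apply, Pi.add_apply, h1 k σ i,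
        h1' k σ i]
    · rw [Prod.snd_add, DFinsupp.add_apply]
      exact Submodule.add_mem _ (h2 k) (h2' k)
    · rw [Prod.snd_add, DFinsupp.add_apply, map_add]
      exact (h3 k).add (h3' k)
    · rw [Prod.fst_add, h4, h4', Finsupp.sum_add_index' (by simp) (by simp [smul_add])]
  zero_mem' := by
    refine ⟨fun k σ i => by simp, fun k => Submodule.zero_mem _, 0, fun k => ?_, by simp⟩
    rw [Prod.snd_zero, DFinsupp.zero_apply, map_zero]
    exact IsSkorokhodIter.zero k
  smul_mem' := by
    rintro c p ⟨h1, h2, s, h3, h4⟩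
    refine ⟨fun k σ i => ?_, fun k => ?_, c • s, fun k => ?_, ?_⟩
    · rw [Prod.smul_snd, DFinsupp.smul_apply, lp.coeFn_smul, Pi.smul_apply, Pi.smul_apply, h1 k σ i]
    · rw [Prod.smul_snd, DFinsupp.smul_apply]
      exact Submodule.smul_mem _ c (h2 k)
    · exact (h3 k).smul c
    · rw [Prod.smul_fst, h4, Finsupp.sum_smul_index' (by simp), Finsupp.smul_sum]
      simp only [smul_comm c]

/-- The space of simple random elements `η₀ + ∑_{k = 1}^N (1 / k!) δᵏ(η_k)`, with their kernels. -/
def Simple (P : Measure Ω) (W : U → Ω → ℝ) (u : HilbertBasis ι ℝ U) (q : ι → ℝ) (r : ℝ)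
    (X : Type*) [NormedAddCommGroup X] [InnerProductSpace ℝ X] [IsFiniteMeasure P] : Type _ :=
  simpleSubmodule P W u q r X

namespace Simple

variable {P : Measure Ω} [IsFiniteMeasure P] {W : U → Ω → ℝ} {u : HilbertBasis ι ℝ U} {q : ι → ℝ}
  {r : ℝ}

instance : AddCommGroup (Simple P W u q r X) :=
  inferInstanceAs (AddCommGroup (simpleSubmodule P W u q r X))

instance : Module ℝ (Simple P W u q r X) :=
  inferInstanceAs (Module ℝ (simpleSubmodule P W u q r X))

/-- The random element itself. -/
def rv (p : Simple P W u q r X) : Lp X 2 P := p.1.1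

/-- `Λ_Q^r η_k`, where `η_k` is the kernel of order `k`. -/
def lambdaKernel (p : Simple P W u q r X) (k : ℕ) : Tensor ι X k :=
  lambdaQ X q r k ⟨p.1.2 k, p.2.2.1 k⟩

lemma lambdaKernel_add (p p' : Simple P W u q r X) (k : ℕ) :
    (p + p').lambdaKernel k = p.lambdaKernel k + p'.lambdaKernel k :=
  (lambdaQ X q r k).map_add ⟨p.1.2 k, p.2.2.1 k⟩ ⟨p'.1.2 k, p'.2.2.1 k⟩

lemma lambdaKernel_smul (c : ℝ) (p : Simple P W u q r X) (k : ℕ) :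
    (c • p).lambdaKernel k = c • p.lambdaKernel k :=
  (lambdaQ X q r k).map_smul c ⟨p.1.2 k, p.2.2.1 k⟩

lemma lambdaKernel_zero (k : ℕ) : (0 : Simple P W u q r X).lambdaKernel k = 0 :=
  (lambdaQ X q r k).map_zero

lemma memℓp_lambdaKernel (p : Simple P W u q r X) :
    Memℓp (fun k : ℕ => (1 / (k.factorial : ℝ)) • p.lambdaKernel k) 2 := by
  classical
  refine (memℓp_zero ?_).of_exponent_ge zero_le
  refine (p.1.2.support.finite_toSet).subset fun k hk => ?_
  by_contra hk'
  refine hk ?_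
  have h0 : p.1.2 k = 0 := by simpa using hk'
  have h1 : (⟨p.1.2 k, p.2.2.1 k⟩ : (lambdaQ X q r k).domain) = 0 := Subtype.ext h0
  change (1 / (k.factorial : ℝ)) • lambdaQ X q r k ⟨p.1.2 k, p.2.2.1 k⟩ = 0
  rw [h1, LinearPMap.map_zero, smul_zero]

/-- The scaled kernels `(1 / k!) Λ_Q^r η_k` as an element of a Hilbert direct sum. -/
def toLp (p : Simple P W u q r X) : lp (fun k : ℕ => Tensor ι X k) 2 :=
  ⟨_, p.memℓp_lambdaKernel⟩

lemma toLp_add (p p' : Simple P W u q r X) : (p + p').toLp = p.toLp + p'.toLp := by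
  ext1
  funext k
  change (1 / (k.factorial : ℝ)) • (p + p').lambdaKernel k = _
  rw [lambdaKernel_add, smul_add]
  rfl

lemma toLp_smul (c : ℝ) (p : Simple P W u q r X) : (c • p).toLp = c • p.toLp := by
  ext1
  funext k
  change (1 / (k.factorial : ℝ)) • (c • p).lambdaKernel k = _
  rw [lambdaKernel_smul, smul_comm]
  rfl

/-- `‖η‖_{Q,r;X} = (‖η₀‖² + ∑_{k ≥ 1} (1 / (k!)²) ‖Λ_Q^r η_k‖²)^{1/2}`
(a sum with finitely many non-zero terms). -/
def normQ (p : Simple P W u q r X) : ℝ :=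
  √(∑' k : ℕ, 1 / (k.factorial : ℝ) ^ 2 * ‖p.lambdaKernel k‖ ^ 2)

lemma normQ_eq (p : Simple P W u q r X) : p.normQ = ‖p.toLp‖ := by
  have h := lp.norm_rpow_eq_tsum (p := 2) (by norm_num) p.toLp
  simp only [ENNReal.toReal_ofNat, Real.rpow_ofNat] at h
  rw [normQ, ← Real.sqrt_sq (norm_nonneg p.toLp), h]
  congr 2
  funext k
  change _ = ‖(1 / (k.factorial : ℝ)) • p.lambdaKernel k‖ ^ 2
  rw [norm_smul, mul_pow, Real.norm_eq_abs, sq_abs, div_pow, one_pow]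

instance : SeminormedAddCommGroup (Simple P W u q r X) :=
  AddGroupSeminorm.toSeminormedAddCommGroup
    { toFun := normQ
      map_zero' := by
        have h : (0 : Simple P W u q r X).toLp = 0 := by
          have := toLp_smul (0 : ℝ) (0 : Simple P W u q r X)
          rwa [zero_smul, zero_smul] at this
        rw [normQ_eq, h, norm_zero]
      add_le' := by
        intro p p'
        rw [normQ_eq, normQ_eq, normQ_eq, toLp_add]
        exact norm_add_le _ _
      neg' := by
        intro p
        rw [normQ_eq, normQ_eq, ← neg_one_smul ℝ p, toLp_smul, neg_one_smul, norm_neg] }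

end Simple

/-- The space `(L)_{Q,r}(Ω; X)`: the closure (completion) of the simple random elements with respect
to the norm `‖·‖_{Q,r;X}`. -/
abbrev LSpace (P : Measure Ω) (W : U → Ω → ℝ) (u : HilbertBasis ι ℝ U) (q : ι → ℝ) (r : ℝ)
    (X : Type*) [NormedAddCommGroup X] [InnerProductSpace ℝ X] [IsFiniteMeasure P] : Type _ :=
  UniformSpace.Completion (Simple P W u q r X)

/-- The element `x` of `(L)_{Q,r}(Ω; X)` is given by the formal series `∑_α η_α ξ_α`:
it is the limit in `(L)_{Q,r}(Ω; X)` of simple random elements whose Cameron-Martin coefficients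
`E (g ξ_α)` converge to `η_α`, for every `α`. -/
def IsFormalSeries {P : Measure Ω} [IsFiniteMeasure P] {W : U → Ω → ℝ} {u : HilbertBasis ι ℝ U}
    {q : ι → ℝ} {r : ℝ} (x : LSpace P W u q r X) (η : (ι →₀ ℕ) → X) : Prop :=
  ∃ g : ℕ → Simple P W u q r X,
    Tendsto (fun m => (g m : LSpace P W u q r X)) atTop (𝓝 x) ∧
    ∀ α, Tendsto (fun m => ∫ ω, xi u W α ω • (g m).rv ω ∂P) atTop (𝓝 (η α))

end GaussianChaos

end

noncomputable section

namespace GaussianChaos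

set_option linter.unusedSectionVars false

open ProbabilityTheory

/-! ### Gaussian integration by parts -/

/-! The weighted Cameron-Martin coefficients identify `(L)_{Q,r}(X)` with `ℓ²` over multi-indices,
and the theorem is read off from this identification.

Write `H_α` for the product of Hermite polynomials and `e_k` for the multi-index of one letter. For
`φ` in the domain of `D`, Gaussian integration by parts gives `E(φ H_{β+e_k}) = E((u_k, Dφ) H_β)`
(`integral_mul_herm_add_single`). This shows that `δ` turns `H_β x ⊗ u_i ⊗ u_k` into `H_{β+e_k} x ⊗
u_i`, so the required iterated integrals exist. Conversely, testing `δⁿ(f)` against `H_α` strips one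
letter at a time and leaves `α!` times the sum of `f` over the words of content `α`. There are
`n!/α!` such words when `|α| = n`, and a symmetric kernel takes one value `f_α` on all of them.
After the normalization `1/n!`, this gives `E(ξ_α g) = f_α/√α!` (`Simple.coeff_content`).

Grouping `∑_n (1/n!²) ‖Λ f_n‖²` by content, the class of `α` contributes `(1/n!²)(n!/α!) q^{2rα}
‖f_α‖²`, that is `(1/n!) q^{2rα} ‖E(ξ_α g)‖²` (`Simple.hasSum_weight_mul_coeff`). Simple elements
therefore embed isometrically in `ℓ²`, densely because every finitely supported family occurs. The
completion is mapped onto `ℓ²`, and a formal series determines, and is determined by, its image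
(`LSpace.isFormalSeries_iff`). -/

lemma hasDerivAt_gaussianPDFReal (x : ℝ) :
    HasDerivAt (gaussianPDFReal 0 1) (-x * gaussianPDFReal 0 1 x) x := by
  have h1 : HasDerivAt (fun y : ℝ => -(y - 0) ^ 2 / (2 * ((1 : NNReal) : ℝ))) (-x) x := by
    have := (((hasDerivAt_id x).sub_const 0).pow 2).neg.div_const (2 * ((1 : NNReal) : ℝ))
    exact this.congr_deriv (by norm_num; ring)
  have h2 := (h1.exp).const_mul ((√(2 * Real.pi * ((1 : NNReal) : ℝ)))⁻¹)
  refine h2.congr_deriv ?_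
  rw [gaussianPDFReal]
  ring

lemma integrable_gaussianReal_iff {f : ℝ → ℝ} :
    Integrable f (gaussianReal 0 1) ↔ Integrable fun x => gaussianPDFReal 0 1 x * f x := by
  rw [gaussianReal_of_var_ne_zero 0 one_ne_zero,
    integrable_withDensity_iff_integrable_smul' (measurable_gaussianPDF _ _)
      (ae_of_all _ fun _ => gaussianPDF_lt_top)]
  simp only [toReal_gaussianPDF, smul_eq_mul]

/-- **Stein's identity** for the standard Gaussian measure on the real line. -/
lemma integral_mul_gaussianReal_eq_integral_deriv {f f' : ℝ → ℝ}
    (hd : ∀ x, HasDerivAt f (f' x) x) (hf : Integrable f (gaussianReal 0 1))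
    (hf' : Integrable f' (gaussianReal 0 1))
    (hxf : Integrable (fun x => x * f x) (gaussianReal 0 1)) :
    ∫ x, x * f x ∂gaussianReal 0 1 = ∫ x, f' x ∂gaussianReal 0 1 := by
  rw [← sub_eq_zero, ← integral_sub hxf hf', integral_gaussianReal_eq_integral_smul one_ne_zero]
  rw [integrable_gaussianReal_iff] at hf
  have hsub : Integrable fun x => gaussianPDFReal 0 1 x * (x * f x - f' x) :=
    integrable_gaussianReal_iff.1 (hxf.sub hf')
  -- The derivative of density times `f` is minus the density times `x f - f'`. A function that is
  -- integrable together with its derivative has a derivative of integral zero.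
  have h := integral_eq_zero_of_hasDerivAt_of_integrable
    (f := fun x => gaussianPDFReal 0 1 x * f x)
    (f' := fun x => -(gaussianPDFReal 0 1 x * (x * f x - f' x)))
    (fun x => ((hasDerivAt_gaussianPDFReal x).mul (hd x)).congr_deriv (by ring)) hsub.neg hf
  rw [integral_neg, neg_eq_zero] at h
  simpa only [smul_eq_mul] using h

variable {Ω : Type*} [MeasurableSpace Ω]

/-- **Stein's identity** in one Gaussian variable independent of the remaining randomness. -/
lemma integral_mul_eq_integral_deriv_of_indepFun {P : Measure Ω} [IsProbabilityMeasure P]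
    {E : Type*} [MeasurableSpace E] {Y : Ω → ℝ} {V : Ω → E} (hY : Measurable Y) (hV : Measurable V)
    (hYV : IndepFun Y V P) (hlaw : P.map Y = gaussianReal 0 1) {G G' : ℝ × E → ℝ}
    (hG : Measurable G) (hG' : Measurable G')
    (hd : ∀ v y, HasDerivAt (fun y => G (y, v)) (G' (y, v)) y)
    (h1 : Integrable (fun ω => G (Y ω, V ω)) P) (h2 : Integrable (fun ω => G' (Y ω, V ω)) P)
    (h3 : Integrable (fun ω => Y ω * G (Y ω, V ω)) P) :
    ∫ ω, Y ω * G (Y ω, V ω) ∂P = ∫ ω, G' (Y ω, V ω) ∂P := by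
  have hlaw2 : P.map (fun ω => (Y ω, V ω)) = (gaussianReal 0 1).prod (P.map V) := by
    rw [(indepFun_iff_map_prod_eq_prod_map_map hY.aemeasurable hV.aemeasurable).1 hYV, hlaw]
  have hYVm : Measurable fun ω => (Y ω, V ω) := hY.prodMk hV
  have : IsProbabilityMeasure (P.map V) := Measure.isProbabilityMeasure_map hV.aemeasurable
  -- Independence makes the joint law a product. Fubini with the Gaussian variable innermost reduces
  -- the claim to the line, for almost every `v`.
  have key : ∀ {K : ℝ × E → ℝ}, Measurable K → Integrable (fun ω => K (Y ω, V ω)) P →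
      Integrable K ((gaussianReal 0 1).prod (P.map V)) ∧
        ∫ ω, K (Y ω, V ω) ∂P = ∫ v, ∫ y, K (y, v) ∂gaussianReal 0 1 ∂P.map V := by
    intro K hK hi
    have hi' : Integrable K ((gaussianReal 0 1).prod (P.map V)) := by
      rw [← hlaw2]
      exact (integrable_map_measure hK.aestronglyMeasurable hYVm.aemeasurable).2 hi
    refine ⟨hi', ?_⟩
    rw [← integral_prod_symm K hi', ← hlaw2,
      integral_map hYVm.aemeasurable hK.aestronglyMeasurable]
  have hyG : Measurable fun p : ℝ × E => p.1 * G p := measurable_fst.mul hG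
  obtain ⟨i1, -⟩ := key hG h1
  obtain ⟨i2, e2⟩ := key hG' h2
  obtain ⟨i3, e3⟩ := key hyG h3
  rw [e2, e3]
  refine integral_congr_ae ?_
  filter_upwards [i1.prod_left_ae, i2.prod_left_ae, i3.prod_left_ae] with v a1 a2 a3
  exact integral_mul_gaussianReal_eq_integral_deriv (hd v) a1 a2 a3

variable {U : Type*} [NormedAddCommGroup U] [InnerProductSpace ℝ U]
variable {X : Type*} [NormedAddCommGroup X] [InnerProductSpace ℝ X]
variable {ι : Type*}

/-! ### White noise: almost sure linearity and orthogonal splitting -/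

namespace IsWhiteNoise

variable {P : Measure Ω} {W : U → Ω → ℝ}

lemma memLp (hW : IsWhiteNoise W P) (h : U) {p : ℝ≥0∞} (hp : p ≠ ∞) : MemLp (W h) p P :=
  (hW.gaussian.hasGaussianLaw_eval h).memLp hp

lemma integrable_mul (hW : IsWhiteNoise W P) (g h : U) :
    Integrable (fun ω => W g ω * W h ω) P :=
  (hW.memLp (p := 2) g (by norm_num)).integrable_mul (hW.memLp (p := 2) h (by norm_num))

lemma covariance_eq [IsProbabilityMeasure P] (hW : IsWhiteNoise W P) (g h : U) :
    cov[W g, W h; P] = inner ℝ g h := by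
  rw [covariance_eq_sub (hW.memLp g (by norm_num)) (hW.memLp h (by norm_num)), hW.mean, hW.mean]
  simpa using hW.cov g h

lemma map_eq_gaussianReal [IsProbabilityMeasure P] (hW : IsWhiteNoise W P) {h : U} (hh : ‖h‖ = 1) :
    P.map (W h) = gaussianReal 0 1 := by
  rw [(hW.gaussian.hasGaussianLaw_eval h).map_eq_gaussianReal, hW.mean,
    ← covariance_self (hW.measurable h).aemeasurable, hW.covariance_eq,
    real_inner_self_eq_norm_sq, hh]
  norm_num

/-- White noise is linear, almost surely. -/
lemma smul_add_ae_eq (hW : IsWhiteNoise W P) (a : ℝ) (g h : U) :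
    W (a • g + h) =ᵐ[P] fun ω => a * W g ω + W h ω := by
  set k := a • g + h with hk
  have hexp : ∀ ω, (W k ω - (a * W g ω + W h ω)) ^ 2 = W k ω * W k ω + a ^ 2 * (W g ω * W g ω) +
      W h ω * W h ω + 2 * a * (W g ω * W h ω) - 2 * a * (W k ω * W g ω) - 2 * (W k ω * W h ω) :=
    fun ω => by ring
  have i := hW.integrable_mul
  -- Linearity is not assumed: bilinearity of the covariance makes the second moment of the defect
  -- vanish.
  have hint : ∫ ω, (W k ω - (a * W g ω + W h ω)) ^ 2 ∂P = 0 := by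
    simp only [hexp]
    have i1 := i k k
    have i2 := (i g g).const_mul (a ^ 2)
    have i3 := i h h
    have i4 := (i g h).const_mul (2 * a)
    have i5 := (i k g).const_mul (2 * a)
    have i6 := (i k h).const_mul 2
    rw [integral_sub (by fun_prop) i6, integral_sub (by fun_prop) i5,
      integral_add (by fun_prop) i4, integral_add (by fun_prop) i3, integral_add i1 i2]
    simp only [integral_const_mul, hW.cov]
    simp only [hk, inner_add_left, inner_add_right, real_inner_smul_left, real_inner_smul_right,
      real_inner_comm g h]
    ring
  have hi : Integrable (fun ω => (W k ω - (a * W g ω + W h ω)) ^ 2) P := by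
    simp only [hexp]
    exact (((((i k k).add ((i g g).const_mul (a ^ 2))).add (i h h)).add
      ((i g h).const_mul (2 * a))).sub ((i k g).const_mul (2 * a))).sub ((i k h).const_mul 2)
  rw [integral_eq_zero_iff_of_nonneg (fun ω => sq_nonneg _) hi] at hint
  filter_upwards [hint] with ω hω
  exact sub_eq_zero.1 (pow_eq_zero_iff two_ne_zero |>.1 hω)

/-- The null set depends on `h`, which is harmless for cylinder functions, as they involve finitely
many `h`. -/
lemma ae_eq_proj (hW : IsWhiteNoise W P) (v h : U) :
    W h =ᵐ[P] fun ω => inner ℝ v h * W v ω + W (h - (inner ℝ v h : ℝ) • v) ω := by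
  have := hW.smul_add_ae_eq (inner ℝ v h) v (h - (inner ℝ v h : ℝ) • v)
  rwa [add_sub_cancel] at this

/-- `W v` is independent of the projection of the noise to the orthogonal complement of `v`. -/
lemma indepFun_proj [IsProbabilityMeasure P] (hW : IsWhiteNoise W P) {v : U} (hv : ‖v‖ = 1) :
    IndepFun (W v) (fun ω (h : U) => W (h - (inner ℝ v h : ℝ) • v) ω) P := by
  -- Both blocks evaluate one Gaussian process along a reindexing, so they are jointly Gaussian and
  -- being uncorrelated suffices for independence.
  have hg : IsGaussianProcess
      (Sum.elim (fun _ : Unit => W v) fun h : U => W (h - (inner ℝ v h : ℝ) • v)) P := by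
    have heq : (Sum.elim (fun _ : Unit => W v) fun h : U => W (h - (inner ℝ v h : ℝ) • v)) =
        W ∘ Sum.elim (fun _ : Unit => v) fun h : U => h - (inner ℝ v h : ℝ) • v := by
      funext s
      cases s <;> rfl
    rw [heq]
    exact hW.gaussian.comp_right _
  have h := hg.indepFun_of_covariance_eq_zero (fun _ => (hW.measurable _).aemeasurable)
    (fun _ => (hW.measurable _).aemeasurable) fun _ h => by
      rw [hW.covariance_eq, inner_sub_right, real_inner_smul_right, real_inner_self_eq_norm_sq, hv]
      ring
  exact h.comp (measurable_pi_apply ()) measurable_id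

end IsWhiteNoise

/-! ### Products of Hermite polynomials -/

open Polynomial in
-- Differentiating the recursion `H_{n+1} = X H_n - H_n'` and applying the hypothesis reproduces the
-- same recursion one level down.
lemma derivative_hermite_succ (n : ℕ) :
    derivative (hermite (n + 1)) = ((n + 1 : ℕ) : ℤ[X]) * hermite n := by
  induction n with
  | zero => simp
  | succ n ih =>
    rw [hermite_succ (n + 1), derivative_sub, derivative_mul, derivative_X, ih, derivative_mul,
      derivative_natCast, hermite_succ n]
    push_cast
    ring

lemma derivative_hermite (n : ℕ) :
    Polynomial.derivative (Polynomial.hermite n) =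
      (n : Polynomial ℤ) * Polynomial.hermite (n - 1) := by
  cases n with
  | zero => simp
  | succ n => exact derivative_hermite_succ n

/-- The unnormalized Cameron-Martin functions `∏ₖ H_{αₖ}(W(uₖ))`. -/
def herm (u : HilbertBasis ι ℝ U) (W : U → Ω → ℝ) (α : ι →₀ ℕ) (ω : Ω) : ℝ :=
  α.prod fun k n => Polynomial.aeval (W (u k) ω) (Polynomial.hermite n)

/-- `α! = ∏ₖ αₖ!`. -/
def mfact (α : ι →₀ ℕ) : ℕ := α.prod fun _ n => n.factorial

lemma mfact_pos (α : ι →₀ ℕ) : 0 < mfact α := Finset.prod_pos fun _ _ => Nat.factorial_pos _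

variable {P : Measure Ω} {W : U → Ω → ℝ} {u : HilbertBasis ι ℝ U}

lemma xi_eq_herm (α : ι →₀ ℕ) (ω : Ω) : xi u W α ω = herm u W α ω / √(mfact α : ℝ) := by
  rw [xi, herm, mfact, Finsupp.prod, Finsupp.prod, Finsupp.prod, Finset.prod_div_distrib,
    Nat.cast_prod, Real.sqrt_prod _ fun _ _ => Nat.cast_nonneg _]

lemma herm_zero (ω : Ω) : herm u W 0 ω = 1 := by simp [herm]

/-- By Hölder with exponents `2p, 2p`, variables with all finite moments are closed under products;
polynomials in Gaussians are handled this way. -/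
lemma memLp_mul_of_ne_top {f g : Ω → ℝ} (hf : ∀ p : ℝ≥0∞, p ≠ ∞ → MemLp f p P)
    (hg : ∀ p : ℝ≥0∞, p ≠ ∞ → MemLp g p P) (p : ℝ≥0∞) (hp : p ≠ ∞) :
    MemLp (fun ω => f ω * g ω) p P := by
  have : ENNReal.HolderTriple (2 * p) (2 * p) p := by
    constructor
    by_cases h0 : p = 0
    · simp [h0]
    rw [ENNReal.mul_inv (by simp) (by simp), ← add_mul, ENNReal.inv_two_add_inv_two, one_mul]
  exact (hg (2 * p) (by finiteness)).mul' (hf (2 * p) (by finiteness))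

lemma memLp_aeval [IsFiniteMeasure P] {f : Ω → ℝ} (hf : ∀ p : ℝ≥0∞, p ≠ ∞ → MemLp f p P)
    (s : Polynomial ℤ) (p : ℝ≥0∞) (hp : p ≠ ∞) :
    MemLp (fun ω => Polynomial.aeval (f ω) s) p P := by
  have hpow : ∀ (n : ℕ) (p : ℝ≥0∞), p ≠ ∞ → MemLp (fun ω => f ω ^ n) p P := by
    intro n
    induction n with
    | zero => intro p _; simpa using memLp_const 1
    | succ n ih => simpa only [pow_succ] using memLp_mul_of_ne_top ih hf
  simp only [Polynomial.aeval_eq_sum_range, zsmul_eq_mul]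
  exact memLp_finsetSum _ fun n _ => (hpow n p hp).const_mul _

lemma memLp_herm [IsFiniteMeasure P] (hW : IsWhiteNoise W P) (α : ι →₀ ℕ) (p : ℝ≥0∞)
    (hp : p ≠ ∞) : MemLp (herm u W α) p P := by
  classical
  have : ∀ s : Finset ι, ∀ p : ℝ≥0∞, p ≠ ∞ → MemLp
      (fun ω => ∏ k ∈ s, Polynomial.aeval (W (u k) ω) (Polynomial.hermite (α k))) p P := by
    intro s
    induction s using Finset.induction_on with
    | empty => intro p _; simpa using memLp_const 1
    | insert a s ha ih =>
      simp only [Finset.prod_insert ha]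
      exact memLp_mul_of_ne_top (memLp_aeval (fun p hp => hW.memLp _ hp) _) ih
  exact this _ p hp

lemma herm_eq_mul_erase (β : ι →₀ ℕ) (k : ι) (ω : Ω) :
    herm u W β ω = Polynomial.aeval (W (u k) ω) (Polynomial.hermite (β k)) *
      herm u W (β.erase k) ω := by
  classical
  exact (Finsupp.mul_prod_erase' β k _ fun _ => by simp).symm

lemma erase_add_single (β : ι →₀ ℕ) (k : ι) (n : ℕ) :
    (β + Finsupp.single k n).erase k = β.erase k := by
  classical
  rw [Finsupp.erase_add, Finsupp.erase_single, add_zero]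

lemma herm_add_single (β : ι →₀ ℕ) (k : ι) (ω : Ω) :
    herm u W (β + Finsupp.single k 1) ω =
      Polynomial.aeval (W (u k) ω) (Polynomial.hermite (β k + 1)) * herm u W (β.erase k) ω := by
  rw [herm_eq_mul_erase _ k, erase_add_single]
  simp

lemma inner_basis_of_ne {k l : ι} (h : k ≠ l) : inner ℝ (u k) (u l) = 0 :=
  u.orthonormal.2 h

/-- By orthogonality, projecting off `u k` leaves the other basis vectors fixed. The remaining
factors thus depend only on the part of the noise independent of `W (u k)`. -/
lemma herm_erase_eq (β : ι →₀ ℕ) (k : ι) (ω : Ω) :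
    herm u W (β.erase k) ω = herm u
      (fun h ω => W (h - (inner ℝ (u k) h : ℝ) • u k) ω) (β.erase k) ω := by
  refine Finset.prod_congr rfl fun l hl => ?_
  have hlk : k ≠ l := by
    rintro rfl
    simp at hl
  simp only [inner_basis_of_ne hlk, zero_smul, sub_zero]

/-! ### Integration by parts against Hermite products -/

lemma sum_fderiv_single {N : ℕ} (L : (Fin N → ℝ) →L[ℝ] ℝ) (a : Fin N → ℝ) :
    ∑ i, L (Pi.single i 1) * a i = L a := by
  conv_rhs => rw [pi_eq_sum_univ' a, map_sum]
  refine Finset.sum_congr rfl fun i _ => ?_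
  rw [map_smul, smul_eq_mul, mul_comm]

lemma integrable_mul_herm [IsProbabilityMeasure P] (hW : IsWhiteNoise W P) {f : Ω → ℝ}
    (hf : MemLp f 2 P) (β : ι →₀ ℕ) : Integrable (fun ω => f ω * herm u W β ω) P :=
  hf.integrable_mul (memLp_herm hW β 2 (by norm_num))

/-- Gaussian integration by parts for smooth cylindrical random variables. -/
lemma integral_mul_herm_add_single_of_cylinder [IsProbabilityMeasure P] (hW : IsWhiteNoise W P)
    {p : Lp ℝ 2 P × Lp U 2 P} (hp : p ∈ cylinderGraph P W) (β : ι →₀ ℕ) (k : ι) :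
    ∫ ω, p.1 ω * herm u W (β + Finsupp.single k 1) ω ∂P =
      ∫ ω, inner ℝ (u k) (p.2 ω) * herm u W β ω ∂P := by
  obtain ⟨N, F, h, hF, h1, h2⟩ := hp
  set a : Fin N → ℝ := fun i => inner ℝ (u k) (h i) with ha
  set V : Ω → U → ℝ := fun ω h => W (h - (inner ℝ (u k) h : ℝ) • u k) ω with hV
  set Y : Ω → ℝ := W (u k) with hY
  -- The arguments of `F` in split coordinates: `z.1` stands for `W (u k)`, and `z.2` for the
  -- projected noise.
  set A : ℝ × (U → ℝ) → Fin N → ℝ := fun z i => a i * z.1 + z.2 (h i) with hA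
  set R : (U → ℝ) → ℝ := fun v => herm u (fun h (_ : Unit) => v h) (β.erase k) () with hR
  set H : ℕ → ℝ → ℝ := fun n y => Polynomial.aeval y (Polynomial.hermite n) with hH
  set n := β k with hn
  have hFC : ContDiff ℝ 1 F := hF.1.of_le (by exact_mod_cast le_top)
  have hFd : Differentiable ℝ F := hFC.differentiable (by norm_num)
  set G : ℝ × (U → ℝ) → ℝ := fun z => F (A z) * H n z.1 * R z.2 with hG
  set T : ℝ × (U → ℝ) → ℝ := fun z => fderiv ℝ F (A z) a * H n z.1 * R z.2 with hT
  set S : ℝ × (U → ℝ) → ℝ := fun z => F (A z) * H (n + 1) z.1 * R z.2 with hS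
  -- The derivative of `G` in its first variable, with `H_n'` written as `y H_n - H_{n+1}`. In
  -- Stein's identity `E(YG) = E(G')` the terms `E(YG)` cancel, leaving `E(S) = E(T)`, the claim.
  set G' : ℝ × (U → ℝ) → ℝ := fun z => T z + z.1 * G z - S z with hG'
  have mA : Measurable A := by
    refine measurable_pi_lambda _ fun i => ?_
    exact (measurable_fst.const_mul _).add ((measurable_pi_apply _).comp measurable_snd)
  have mH : ∀ n, Measurable (H n) := fun n => (Polynomial.continuous_aeval _).measurable
  have mR : Measurable R := by
    refine Finset.measurable_fun_prod _ fun l _ => ?_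
    exact (Polynomial.continuous_aeval _).measurable.comp (measurable_pi_apply _)
  have mF : Measurable fun z => F (A z) := hFC.continuous.measurable.comp mA
  have mF' : Measurable fun z => fderiv ℝ F (A z) a := by
    have : Continuous fun x => fderiv ℝ F x a :=
      (hFC.continuous_fderiv (by norm_num)).clm_apply continuous_const
    exact this.measurable.comp mA
  have mG : Measurable G := (mF.mul ((mH n).comp measurable_fst)).mul (mR.comp measurable_snd)
  have mT : Measurable T := (mF'.mul ((mH n).comp measurable_fst)).mul (mR.comp measurable_snd)
  have mS : Measurable S :=
    (mF.mul ((mH (n + 1)).comp measurable_fst)).mul (mR.comp measurable_snd)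
  have mG' : Measurable G' := (mT.add (measurable_fst.mul mG)).sub mS
  have hderH : ∀ y, HasDerivAt (H n) (y * H n y - H (n + 1) y) y := by
    intro y
    refine (Polynomial.hasDerivAt_aeval _ y).congr_deriv ?_
    simp only [hH, Polynomial.hermite_succ, map_sub, map_mul, Polynomial.aeval_X]
    ring
  have hd : ∀ v y, HasDerivAt (fun y => G (y, v)) (G' (y, v)) y := by
    intro v y
    have hA' : HasDerivAt (fun y => A (y, v)) a y := by
      refine hasDerivAt_pi.2 fun i => ?_
      exact (((hasDerivAt_id y).const_mul (a i)).add_const (v (h i))).congr_deriv (mul_one _)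
    have hFA : HasDerivAt (fun y => F (A (y, v))) (fderiv ℝ F (A (y, v)) a) y :=
      (hFd _).hasFDerivAt.comp_hasDerivAt y hA'
    refine ((hFA.mul (hderH y)).mul_const (R v)).congr_deriv ?_
    simp only [hG', hT, hG, hS]
    ring
  have hRV : ∀ ω, R (V ω) = herm u W (β.erase k) ω := fun ω => (herm_erase_eq β k ω).symm
  have hherm : ∀ ω, H n (Y ω) * R (V ω) = herm u W β ω := fun ω => by
    rw [hRV, herm_eq_mul_erase β k]
  have hherm' : ∀ ω, H (n + 1) (Y ω) * R (V ω) = herm u W (β + Finsupp.single k 1) ω := fun ω => by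
    rw [hRV, herm_add_single β k]
  have hAW : ∀ᵐ ω ∂P, A (Y ω, V ω) = fun i => W (h i) ω := by
    have := ae_all_iff.2 fun i => hW.ae_eq_proj (u k) (h i)
    filter_upwards [this] with ω hω
    funext i
    exact (hω i).symm
  have eG : (fun ω => G (Y ω, V ω)) =ᵐ[P] fun ω => p.1 ω * herm u W β ω := by
    filter_upwards [hAW, h1] with ω hω h1
    simp only [hG]
    rw [h1, hω, mul_assoc, hherm]
  have eS : (fun ω => S (Y ω, V ω)) =ᵐ[P]
      fun ω => p.1 ω * herm u W (β + Finsupp.single k 1) ω := by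
    filter_upwards [hAW, h1] with ω hω h1
    simp only [hS]
    rw [h1, hω, mul_assoc, hherm']
  have eT : (fun ω => T (Y ω, V ω)) =ᵐ[P] fun ω => inner ℝ (u k) (p.2 ω) * herm u W β ω := by
    filter_upwards [hAW, h2] with ω hω h2
    simp only [hT]
    rw [h2, hω, mul_assoc, hherm, inner_sum]
    simp only [real_inner_smul_right]
    rw [sum_fderiv_single]
  have iG : Integrable (fun ω => G (Y ω, V ω)) P :=
    (integrable_mul_herm hW (Lp.memLp p.1) β).congr eG.symm
  have iS : Integrable (fun ω => S (Y ω, V ω)) P :=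
    (integrable_mul_herm hW (Lp.memLp p.1) _).congr eS.symm
  have iT : Integrable (fun ω => T (Y ω, V ω)) P :=
    (integrable_mul_herm hW (memLp_inner (u k) p.2) β).congr eT.symm
  have iYG : Integrable (fun ω => Y ω * G (Y ω, V ω)) P := by
    have : Integrable (fun ω => p.1 ω * (Y ω * herm u W β ω)) P :=
      (Lp.memLp p.1).integrable_mul (memLp_mul_of_ne_top (fun p hp => hW.memLp _ hp)
        (memLp_herm hW β) 2 (by norm_num))
    refine this.congr ?_
    filter_upwards [eG] with ω hω
    rw [hω]
    ring
  have hu : ‖u k‖ = 1 := u.orthonormal.1 k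
  have mV : Measurable V := measurable_pi_lambda _ fun h => hW.measurable _
  have hst := integral_mul_eq_integral_deriv_of_indepFun (hW.measurable _) mV
    (hW.indepFun_proj hu) (hW.map_eq_gaussianReal hu) mG mG' hd iG ((iT.add iYG).sub iS) iYG
  have hsplit : ∫ ω, G' (Y ω, V ω) ∂P = ∫ ω, T (Y ω, V ω) ∂P + ∫ ω, Y ω * G (Y ω, V ω) ∂P -
      ∫ ω, S (Y ω, V ω) ∂P := by
    have iTY : Integrable (fun ω => T (Y ω, V ω) + Y ω * G (Y ω, V ω)) P := iT.add iYG
    rw [← integral_add iT iYG, ← integral_sub iTY iS]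
  rw [← integral_congr_ae eS, ← integral_congr_ae eT]
  linarith

lemma continuous_integral_mul_herm [IsProbabilityMeasure P] (hW : IsWhiteNoise W P)
    (β : ι →₀ ℕ) : Continuous fun f : Lp ℝ 2 P => ∫ ω, f ω * herm u W β ω ∂P := by
  have hm := memLp_herm (u := u) hW β 2 (by norm_num)
  have : ∀ f : Lp ℝ 2 P, ∫ ω, f ω * herm u W β ω ∂P = inner ℝ (hm.toLp _) f := by
    intro f
    rw [L2.inner_def]
    refine integral_congr_ae ?_
    filter_upwards [hm.coeFn_toLp] with ω hω
    rw [hω]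
    rfl
  simp only [this]
  fun_prop

/-- Gaussian integration by parts on the domain of the Malliavin derivative. -/
lemma integral_mul_herm_add_single [IsProbabilityMeasure P] (hW : IsWhiteNoise W P)
    {p : Lp ℝ 2 P × Lp U 2 P} (hp : p ∈ malliavinGraph P W) (β : ι →₀ ℕ) (k : ι) :
    ∫ ω, p.1 ω * herm u W (β + Finsupp.single k 1) ω ∂P =
      ∫ ω, inner ℝ (u k) (p.2 ω) * herm u W β ω ∂P := by
  have hc1 : Continuous fun p : Lp ℝ 2 P × Lp U 2 P =>
      ∫ ω, p.1 ω * herm u W (β + Finsupp.single k 1) ω ∂P :=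
    (continuous_integral_mul_herm hW _).comp continuous_fst
  have hc2 : Continuous fun p : Lp ℝ 2 P × Lp U 2 P =>
      ∫ ω, inner ℝ (u k) (p.2 ω) * herm u W β ω ∂P := by
    have h : ∀ p : Lp ℝ 2 P × Lp U 2 P, ∫ ω, inner ℝ (u k) (p.2 ω) * herm u W β ω ∂P =
        ∫ ω, (innerSL ℝ (u k)).compLp p.2 ω * herm u W β ω ∂P := by
      intro p
      refine integral_congr_ae ?_
      filter_upwards [(innerSL ℝ (u k)).coeFn_compLp p.2] with ω hω
      rw [hω]
      rfl
    simp only [h]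
    exact (continuous_integral_mul_herm hW _).comp
      (((innerSL ℝ (u k)).compLpL 2 P).continuous.comp continuous_snd)
  have hcl : IsClosed {p : Lp ℝ 2 P × Lp U 2 P |
      ∫ ω, p.1 ω * herm u W (β + Finsupp.single k 1) ω ∂P =
        ∫ ω, inner ℝ (u k) (p.2 ω) * herm u W β ω ∂P} := isClosed_eq hc1 hc2
  exact closure_minimal (fun p hp => integral_mul_herm_add_single_of_cylinder hW hp β k) hcl hp

/-! ### Malliavin derivatives of Hermite products -/

lemma hasTemperateGrowth_aeval {N : ℕ} (s : Polynomial ℤ) (i : Fin N) :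
    Function.HasTemperateGrowth fun x : Fin N → ℝ => Polynomial.aeval (x i) s := by
  simp only [Polynomial.aeval_eq_sum_range, zsmul_eq_mul]
  refine Function.HasTemperateGrowth.sum fun n _ => ?_
  have hproj : Function.HasTemperateGrowth fun x : Fin N → ℝ => x i :=
    (ContinuousLinearMap.proj (R := ℝ) (φ := fun _ : Fin N => ℝ) i).hasTemperateGrowth
  exact (Function.HasTemperateGrowth.const _).mul (hproj.pow n)

lemma hasTemperateGrowth_prod {N : ℕ} {E : Type*} [NormedAddCommGroup E] [NormedSpace ℝ E]
    (s : Finset (Fin N)) {f : Fin N → E → ℝ} (hf : ∀ i, (f i).HasTemperateGrowth) :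
    Function.HasTemperateGrowth fun x => ∏ i ∈ s, f i x := by
  classical
  induction s using Finset.induction_on with
  | empty => simp
  | insert a s ha ih =>
    simp only [Finset.prod_insert ha]
    exact (hf a).mul ih

lemma sub_single_add_single {α : ι →₀ ℕ} {k : ι} (h : 1 ≤ α k) :
    α - Finsupp.single k 1 + Finsupp.single k 1 = α :=
  tsub_add_cancel_of_le (Finsupp.single_le_iff.2 h)

lemma herm_sub_single {α : ι →₀ ℕ} {k : ι} (h : 1 ≤ α k) (ω : Ω) :
    herm u W (α - Finsupp.single k 1) ω =
      Polynomial.aeval (W (u k) ω) (Polynomial.hermite (α k - 1)) * herm u W (α.erase k) ω := by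
  have herase : (α - Finsupp.single k 1).erase k = α.erase k := by
    conv_rhs => rw [← sub_single_add_single h, erase_add_single]
  rw [herm_eq_mul_erase (α - Finsupp.single k 1) k, herase, Finsupp.tsub_apply,
    Finsupp.single_eq_same]

/-- `∏ₖ H_{αₖ}(W(uₖ))` is in the domain of the Malliavin derivative, and
`(uₖ, D (∏ₗ H_{αₗ}(W(uₗ))))_U = αₖ ∏ₗ H_{αₗ - δₖₗ}(W(uₗ))`. -/
lemma exists_cylinderGraph_herm [IsProbabilityMeasure P] (hW : IsWhiteNoise W P) (α : ι →₀ ℕ) :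
    ∃ p ∈ malliavinGraph P W, p.1 =ᵐ[P] herm u W α ∧
      ∀ k, (fun ω => inner ℝ (u k) (p.2 ω)) =ᵐ[P]
        fun ω => (α k : ℝ) * herm u W (α - Finsupp.single k 1) ω := by
  classical
  have hm := memLp_herm (u := u) hW α 2 (by norm_num)
  have hmD : MemLp (fun ω => ∑ k ∈ α.support,
      ((α k : ℝ) * herm u W (α - Finsupp.single k 1) ω) • u k) 2 P := by
    refine memLp_finsetSum _ fun k _ => ?_
    exact ((ContinuousLinearMap.id ℝ ℝ).smulRight (u k)).comp_memLp'
      ((memLp_herm (u := u) hW _ 2 (by norm_num)).const_mul _)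
  refine ⟨(hm.toLp _, hmD.toLp _), subset_closure ?_, hm.coeFn_toLp, fun k => ?_⟩
  · set e := α.support.equivFin.symm with he
    set f : Fin α.support.card → (Fin α.support.card → ℝ) → ℝ := fun i x =>
      Polynomial.aeval (x i) (Polynomial.hermite (α (e i))) with hf
    have hherm : ∀ ω, herm u W α ω = ∏ i, f i fun j => W (u (e j)) ω := by
      intro ω
      rw [herm, Finsupp.prod, ← Finset.prod_coe_sort]
      exact (Equiv.prod_comp e fun k : α.support =>
        Polynomial.aeval (W (u k) ω) (Polynomial.hermite (α k))).symm
    refine ⟨_, fun x => ∏ i, f i x, fun i => u (e i),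
      hasTemperateGrowth_prod _ fun i => hasTemperateGrowth_aeval _ i, ?_, ?_⟩
    · filter_upwards [hm.coeFn_toLp] with ω hω
      rw [hω, hherm]
    · filter_upwards [hmD.coeFn_toLp] with ω hω
      rw [hω, ← Finset.sum_coe_sort, ← Equiv.sum_comp e]
      refine Finset.sum_congr rfl fun i _ => ?_
      congr 1
      set x : Fin α.support.card → ℝ := fun j => W (u (e j)) ω with hx
      have hdf : ∀ j, HasFDerivAt (f j) ((Polynomial.aeval (x j)
          (Polynomial.derivative (Polynomial.hermite (α (e j))))) •
            ContinuousLinearMap.proj (R := ℝ) (φ := fun _ : Fin α.support.card => ℝ) j) x := by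
        intro j
        exact (Polynomial.hasDerivAt_aeval (Polynomial.hermite (α (e j))) (x j)).comp_hasFDerivAt x
          (ContinuousLinearMap.proj (R := ℝ) (φ := fun _ => ℝ) j).hasFDerivAt
      have hd := HasFDerivAt.finsetProd (u := Finset.univ) fun j _ => hdf j
      -- In the `i`-th coordinate direction only the Leibniz term differentiating the `i`-th factor
      -- survives.
      rw [hd.fderiv, _root_.sum_apply, Finset.sum_eq_single i]
      · have hpos : 1 ≤ α (e i) := Nat.one_le_iff_ne_zero.2 (Finsupp.mem_support_iff.1 (e i).2)
        have hprod : ∏ j ∈ Finset.univ.erase i, f j x = herm u W (α.erase (e i)) ω := by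
          rw [herm, Finsupp.prod, Finsupp.support_erase]
          refine Finset.prod_bij (fun j _ => (e j : ι)) ?_ ?_ ?_ ?_
          · intro j hj
            refine Finset.mem_erase.2 ⟨fun h => ?_, (e j).2⟩
            exact (Finset.mem_erase.1 hj).1 (e.injective (Subtype.ext h))
          · intro a _ b _ hab
            exact e.injective (Subtype.ext hab)
          · intro b hb
            obtain ⟨hb1, hb2⟩ := Finset.mem_erase.1 hb
            refine ⟨e.symm ⟨b, hb2⟩, Finset.mem_erase.2 ⟨fun h => hb1 ?_, Finset.mem_univ _⟩, ?_⟩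
            · rw [← h]; simp
            · simp
          · intro j hj
            have : (e j : ι) ≠ e i := fun h =>
              (Finset.mem_erase.1 hj).1 (e.injective (Subtype.ext h))
            simp [hf, hx, Finsupp.erase_ne this]
        rw [herm_sub_single hpos, ← hprod]
        simp only [derivative_hermite, map_mul, map_natCast,
          _root_.smul_apply, ContinuousLinearMap.proj_apply, Pi.single_eq_same,
          smul_eq_mul, hx]
        ring
      · intro j _ hj
        simp [hj]
      · simp
  · filter_upwards [hmD.coeFn_toLp] with ω hω
    rw [hω, inner_sum]
    simp only [real_inner_smul_right]
    rw [Finset.sum_eq_single k]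
    · rw [real_inner_self_eq_norm_sq, u.orthonormal.1 k]
      ring
    · intro l _ hl
      rw [inner_basis_of_ne hl.symm, mul_zero]
    · intro hk
      rw [Finsupp.notMem_support_iff.1 hk]
      simp

/-- `E ∏ₖ H_{αₖ}(W(uₖ)) = 0` unless `α = 0`. -/
lemma integral_herm [IsProbabilityMeasure P] (hW : IsWhiteNoise W P) (α : ι →₀ ℕ)
    [Decidable (α = 0)] : ∫ ω, herm u W α ω ∂P = if α = 0 then 1 else 0 := by
  split_ifs with h
  · subst h
    simp [herm_zero]
  · obtain ⟨k, hk⟩ := Finsupp.ne_iff.1 h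
    have hsub := sub_single_add_single (Nat.one_le_iff_ne_zero.2 hk)
    -- Integration by parts is applied to the constant `1`, which is the Hermite product of index
    -- `0` and has zero derivative.
    obtain ⟨p, hp, h1, h2⟩ := exists_cylinderGraph_herm (u := u) hW 0
    have h := integral_mul_herm_add_single (u := u) hW hp (α - Finsupp.single k 1) k
    rw [hsub] at h
    have e1 : ∫ ω, p.1 ω * herm u W α ω ∂P = ∫ ω, herm u W α ω ∂P := by
      refine integral_congr_ae ?_
      filter_upwards [h1] with ω h1
      rw [h1, herm_zero, one_mul]
    rw [← e1, h]
    refine integral_eq_zero_of_ae ?_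
    filter_upwards [h2 k] with ω h2
    rw [h2]
    simp

/-! ### Words and their contents -/

/-- The multi-index counting the occurrences of each letter in a word. -/
def content {n : ℕ} (i : Fin n → ι) : ι →₀ ℕ := ∑ j, Finsupp.single (i j) 1

lemma content_snoc {n : ℕ} (i : Fin n → ι) (k : ι) :
    content (Fin.snoc i k : Fin (n + 1) → ι) = content i + Finsupp.single k 1 := by
  simp [content, Fin.sum_univ_castSucc]

lemma content_of_isEmpty (i : Fin 0 → ι) : content i = 0 := by simp [content]

lemma degree_content {n : ℕ} (i : Fin n → ι) : (content i).degree = n := by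
  simp [content, map_sum]

lemma content_apply [DecidableEq ι] {n : ℕ} (i : Fin n → ι) (k : ι) :
    content i k = Fintype.card {j // i j = k} := by
  simp [content, Finsupp.finsetSum_apply, Finsupp.single_apply, Fintype.card_subtype]

lemma content_apply_ne_zero {n : ℕ} (i : Fin n → ι) (j : Fin n) : content i (i j) ≠ 0 := by
  classical
  rw [content_apply]
  have : Nonempty {j' // i j' = i j} := ⟨⟨j, rfl⟩⟩
  exact Fintype.card_ne_zero

lemma exists_eq_of_content_apply_ne_zero {n : ℕ} {i : Fin n → ι} {k : ι} (h : content i k ≠ 0) :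
    ∃ j, i j = k := by
  classical
  rw [content_apply] at h
  obtain ⟨j, hj⟩ := Fintype.card_pos_iff.1 (Nat.pos_of_ne_zero h)
  exact ⟨j, hj⟩

lemma content_comp_perm {n : ℕ} (i : Fin n → ι) (σ : Equiv.Perm (Fin n)) :
    content (i ∘ σ) = content i :=
  Equiv.sum_comp σ fun j => Finsupp.single (i j) 1

/-- The fibres over each letter are equinumerous, and bijections between them glue. Hence symmetric
tensors are functions of the content. -/
lemma exists_perm_of_content_eq {n : ℕ} {i i' : Fin n → ι} (h : content i = content i') :
    ∃ σ : Equiv.Perm (Fin n), i' ∘ σ = i := by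
  classical
  have e : ∀ k, Nonempty ({j // i j = k} ≃ {j // i' j = k}) := fun k =>
    Fintype.card_eq.1 ((content_apply i k).symm.trans ((DFunLike.congr_fun h k).trans
      (content_apply i' k)))
  exact ⟨Equiv.ofFiberEquiv fun k => (e k).some, funext fun j => Equiv.ofFiberEquiv_map _ j⟩

/-- The words of length `n` with letters in the support of `α`. -/
def suppWords (n : ℕ) (α : ι →₀ ℕ) : Finset (Fin n → ι) := by
  classical exact Fintype.piFinset fun _ => α.support

lemma mem_suppWords {n : ℕ} {α : ι →₀ ℕ} {i : Fin n → ι} :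
    i ∈ suppWords n α ↔ ∀ j, i j ∈ α.support := by
  simp [suppWords, Fintype.mem_piFinset]

/-- The last letter is split off because it is the one that `IsSkorokhod` integrates out. -/
lemma sum_suppWords_succ {M : Type*} [AddCommMonoid M] (n : ℕ) (α : ι →₀ ℕ)
    (φ : (Fin (n + 1) → ι) → M) :
    ∑ i ∈ suppWords (n + 1) α, φ i =
      ∑ i ∈ suppWords n α, ∑ k ∈ α.support, φ (Fin.snoc i k : Fin (n + 1) → ι) := by
  rw [← Finset.sum_product']
  refine Finset.sum_bij' (fun i _ => (Fin.init i, i (Fin.last n)))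
    (fun z _ => (Fin.snoc z.1 z.2 : Fin (n + 1) → ι)) ?_ ?_ ?_ ?_ ?_
  · intro i hi
    rw [mem_suppWords] at hi
    exact Finset.mem_product.2 ⟨mem_suppWords.2 fun j => hi _, hi _⟩
  · intro z hz
    obtain ⟨h1, h2⟩ := Finset.mem_product.1 hz
    rw [mem_suppWords] at h1 ⊢
    intro j
    refine Fin.lastCases ?_ (fun j => ?_) j
    · simpa using h2
    · simpa using h1 j
  · intro i _
    exact Fin.snoc_init_self i
  · intro z _
    simp
  · intro i _
    rw [Fin.snoc_init_self i]

/-- The words of length `n` and content `α`. -/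
def words (n : ℕ) (α : ι →₀ ℕ) : Finset (Fin n → ι) := by
  classical exact (suppWords n α).filter fun i => content i = α

lemma mem_words {n : ℕ} {α : ι →₀ ℕ} {i : Fin n → ι} : i ∈ words n α ↔ content i = α := by
  simp only [words, Finset.mem_filter, mem_suppWords, and_iff_right_iff_imp]
  rintro rfl j
  exact Finsupp.mem_support_iff.2 (content_apply_ne_zero i j)

lemma mfact_eq_mul_erase (α : ι →₀ ℕ) (k : ι) :
    mfact α = (α k).factorial * mfact (α.erase k) :=
  (Finsupp.mul_prod_erase' α k (fun _ n => n.factorial) fun _ => rfl).symm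

lemma mfact_eq_mul_sub_single {α : ι →₀ ℕ} {k : ι} (h : 1 ≤ α k) :
    mfact α = α k * mfact (α - Finsupp.single k 1) := by
  have herase : (α - Finsupp.single k 1).erase k = α.erase k := by
    conv_rhs => rw [← sub_single_add_single h, erase_add_single]
  rw [mfact_eq_mul_erase α k, mfact_eq_mul_erase (α - Finsupp.single k 1) k, herase, ← mul_assoc,
    Finsupp.tsub_apply, Finsupp.single_eq_same, Nat.mul_factorial_pred (by omega)]

/-- Words are sorted by their last letter `k`, whose removal lowers the content by `e_k`. -/
lemma card_words_succ (n : ℕ) (α : ι →₀ ℕ) :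
    (words (n + 1) α).card = ∑ k ∈ α.support, (words n (α - Finsupp.single k 1)).card := by
  classical
  rw [words, Finset.card_filter, sum_suppWords_succ, Finset.sum_comm]
  refine Finset.sum_congr rfl fun k hk => ?_
  rw [← Finset.card_filter]
  congr 1
  have hk1 : 1 ≤ α k := Nat.one_le_iff_ne_zero.2 (Finsupp.mem_support_iff.1 hk)
  ext i
  rw [Finset.mem_filter, mem_words, content_snoc]
  constructor
  · rintro ⟨-, h⟩
    rw [← h, add_tsub_cancel_right]
  · intro h
    have h' : content i + Finsupp.single k 1 = α := by rw [h, sub_single_add_single hk1]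
    refine ⟨mem_suppWords.2 fun j => Finsupp.mem_support_iff.2 ?_, h'⟩
    have := content_apply_ne_zero i j
    rw [← h', Finsupp.add_apply]
    omega

/-- The number of words of content `α` is the multinomial coefficient `|α|! / α!`. -/
lemma card_words_mul_mfact (n : ℕ) (α : ι →₀ ℕ) (h : α.degree = n) :
    (words n α).card * mfact α = n.factorial := by
  induction n generalizing α with
  | zero =>
    have h0 : α = 0 := (Finsupp.degree_eq_zero_iff α).1 h
    subst h0
    have : words 0 (0 : ι →₀ ℕ) = {Fin.elim0} := by
      ext i
      simp only [mem_words, content_of_isEmpty, Finset.mem_singleton, true_iff]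
      exact Subsingleton.elim _ _
    simp [this, mfact]
  | succ n ih =>
    rw [card_words_succ, Finset.sum_mul]
    -- Since `α! = α_k (α - e_k)!`, the letter `k` contributes `α_k n!`, and the `α_k` add up to `n
    -- + 1`.
    have : ∀ k ∈ α.support, (words n (α - Finsupp.single k 1)).card * mfact α =
        α k * n.factorial := by
      intro k hk
      have hk1 : 1 ≤ α k := Nat.one_le_iff_ne_zero.2 (Finsupp.mem_support_iff.1 hk)
      have hdeg : (α - Finsupp.single k 1).degree = n := by
        have h2 := congrArg Finsupp.degree (sub_single_add_single hk1)
        rw [map_add, h, Finsupp.degree_single] at h2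
        omega
      rw [mfact_eq_mul_sub_single hk1, mul_left_comm, ih _ hdeg]
    rw [Finset.sum_congr rfl this, ← Finset.sum_mul, Nat.factorial_succ]
    congr 1

lemma words_nonempty (α : ι →₀ ℕ) : (words α.degree α).Nonempty := by
  rw [← Finset.card_pos]
  have := card_words_mul_mfact α.degree α rfl
  exact Nat.pos_of_mul_pos_right (this ▸ Nat.factorial_pos _)

lemma words_eq_empty {n : ℕ} {α : ι →₀ ℕ} (h : α.degree ≠ n) : words n α = ∅ := by
  refine Finset.eq_empty_of_forall_notMem fun i hi => h ?_
  rw [← mem_words.1 hi, degree_content]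

/-- The product of falling factorials `∏ₖ αₖ (αₖ - 1) ⋯ (αₖ - γₖ + 1)`. -/
def mdesc (α γ : ι →₀ ℕ) : ℕ := ∏ k ∈ α.support, (α k).descFactorial (γ k)

lemma mdesc_zero (α : ι →₀ ℕ) : mdesc α 0 = 1 := by simp [mdesc]

lemma mdesc_self (α : ι →₀ ℕ) : mdesc α α = mfact α := by
  simp [mdesc, mfact, Finsupp.prod, Nat.descFactorial_self]

lemma mdesc_add_single {α : ι →₀ ℕ} (γ : ι →₀ ℕ) {k : ι} (hk : k ∈ α.support) :
    mdesc α (γ + Finsupp.single k 1) = mdesc α γ * (α - γ) k := by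
  classical
  rw [mdesc, mdesc, ← Finset.mul_prod_erase _ _ hk, ← Finset.mul_prod_erase _ _ hk]
  have : ∏ l ∈ α.support.erase k, (α l).descFactorial ((γ + Finsupp.single k 1 : ι →₀ ℕ) l) =
      ∏ l ∈ α.support.erase k, (α l).descFactorial (γ l) := by
    refine Finset.prod_congr rfl fun l hl => ?_
    rw [Finsupp.add_apply, Finsupp.single_eq_of_ne (Finset.mem_erase.1 hl).1, add_zero]
  rw [this, Finsupp.add_apply, Finsupp.single_eq_same, Nat.descFactorial_succ, Finsupp.tsub_apply]
  ring

/-- Differentiating more often than the degree gives zero. This removes the terms in which the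
subtraction `α - content i` is truncated. -/
lemma mdesc_eq_zero_of_not_le {n : ℕ} {α : ι →₀ ℕ} {i : Fin n → ι} (hi : i ∈ suppWords n α)
    (h : ¬ content i ≤ α) : mdesc α (content i) = 0 := by
  obtain ⟨k, hk⟩ : ∃ k, α k < content i k := by
    by_contra! hc
    exact h hc
  obtain ⟨j, rfl⟩ := exists_eq_of_content_apply_ne_zero (i := i) (k := k) (by omega)
  exact Finset.prod_eq_zero (mem_suppWords.1 hi j) (Nat.descFactorial_eq_zero_iff_lt.2 hk)

/-! ### Duality for the iterated Skorokhod integral -/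

/-- The adjoint relation is tested with `φ = H_α`. As `(u_k, D H_α) = α_k H_{α-e_k}`, the series
over `k` lives on the support of `α`. -/
lemma integral_herm_smul_of_isSkorokhod [IsProbabilityMeasure P] (hW : IsWhiteNoise W P) {n : ℕ}
    {f : Lp (Tensor ι X (n + 1)) 2 P} {g : Lp (Tensor ι X n) 2 P} (h : IsSkorokhod P W u f g)
    (α : ι →₀ ℕ) (i : Fin n → ι) :
    ∫ ω, herm u W α ω • g ω i ∂P = ∑ k ∈ α.support,
      (α k : ℝ) • ∫ ω, herm u W (α - Finsupp.single k 1) ω •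
        f ω (Fin.snoc i k : Fin (n + 1) → ι) ∂P := by
  obtain ⟨p, hp, h1, h2⟩ := exists_cylinderGraph_herm (u := u) hW α
  have hs := h p hp i
  have e1 : ∫ ω, p.1 ω • g ω i ∂P = ∫ ω, herm u W α ω • g ω i ∂P := by
    refine integral_congr_ae ?_
    filter_upwards [h1] with ω h1
    rw [h1]
  have e2 : ∀ k, ∫ ω, inner ℝ (u k) (p.2 ω) • f ω (Fin.snoc i k : Fin (n + 1) → ι) ∂P =
      (α k : ℝ) • ∫ ω, herm u W (α - Finsupp.single k 1) ω •
        f ω (Fin.snoc i k : Fin (n + 1) → ι) ∂P := by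
    intro k
    rw [← integral_smul]
    refine integral_congr_ae ?_
    filter_upwards [h2 k] with ω h2
    rw [h2, mul_smul]
  rw [e1] at hs
  have hs2 := hs.congr_fun fun k => (e2 k).symm
  refine hs2.unique (hasSum_sum_of_ne_finset_zero fun k hk => ?_)
  rw [Finsupp.notMem_support_iff.1 hk, Nat.cast_zero, zero_smul]

/-- Each integration strips one letter, and the factors `(α - γ)_k` collect into a falling
factorial. -/
lemma integral_herm_smul_of_isSkorokhodIter [IsProbabilityMeasure P] (hW : IsWhiteNoise W P)
    {n : ℕ} {f : Lp (Tensor ι X n) 2 P} {g : Lp X 2 P} (h : IsSkorokhodIter P W u n f g)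
    (α : ι →₀ ℕ) :
    ∫ ω, herm u W α ω • g ω ∂P = ∑ i ∈ suppWords n α, (mdesc α (content i) : ℝ) •
      ∫ ω, herm u W (α - content i) ω • f ω i ∂P := by
  induction n with
  | zero =>
    have hsw : suppWords 0 α = {Fin.elim0} := by
      ext i
      simp only [mem_suppWords, Finset.mem_singleton]
      exact ⟨fun _ => Subsingleton.elim _ _, fun _ j => j.elim0⟩
    rw [hsw, Finset.sum_singleton, content_of_isEmpty, mdesc_zero, Nat.cast_one, one_smul, tsub_zero]
    refine integral_congr_ae ?_
    filter_upwards [h] with ω hω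
    rw [hω]
  | succ n ih =>
    obtain ⟨f', h1, h2⟩ := h
    rw [ih h2, sum_suppWords_succ]
    refine Finset.sum_congr rfl fun i _ => ?_
    rw [integral_herm_smul_of_isSkorokhod hW h1, Finset.smul_sum]
    have hsub : (α - content i).support ⊆ α.support := fun k hk => by
      rw [Finsupp.mem_support_iff, Finsupp.tsub_apply] at hk
      exact Finsupp.mem_support_iff.2 (by omega)
    rw [Finset.sum_subset hsub fun k _ hk => by
      rw [Finsupp.notMem_support_iff.1 hk, Nat.cast_zero, zero_smul, smul_zero]]
    refine Finset.sum_congr rfl fun k hk => ?_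
    rw [content_snoc, mdesc_add_single _ hk, tsub_tsub, smul_smul, Nat.cast_mul]

/-- `E (∏ₖ H_{αₖ}(W(uₖ)) δⁿ(f)) = α! ∑ f(i)` over the words `i` of content `α`,
for deterministic `f`. -/
lemma integral_herm_smul_of_isSkorokhodIter_const [IsProbabilityMeasure P] [CompleteSpace X]
    (hW : IsWhiteNoise W P) {n : ℕ} {f : Tensor ι X n} {g : Lp X 2 P}
    (h : IsSkorokhodIter P W u n (Lp.const 2 P f) g) (α : ι →₀ ℕ) :
    ∫ ω, herm u W α ω • g ω ∂P = (mfact α : ℝ) • ∑ i ∈ words n α, f i := by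
  classical
  rw [integral_herm_smul_of_isSkorokhodIter hW h, words, Finset.sum_filter, Finset.smul_sum]
  refine Finset.sum_congr rfl fun i hi => ?_
  have hc : ∫ ω, herm u W (α - content i) ω • (Lp.const 2 P f) ω i ∂P =
      (if α - content i = 0 then (1 : ℝ) else 0) • f i := by
    rw [← integral_herm hW (u := u) (α - content i), ← integral_smul_const]
    refine integral_congr_ae ?_
    filter_upwards [Lp.coeFn_const (p := 2) (μ := P) f] with ω hω
    rw [hω, Function.const_apply]
  rw [hc]
  -- Truncated subtraction vanishes also when `α` lies strictly below `content i`; there `mdesc` is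
  -- zero. Otherwise only `content i = α` survives the expectation.
  by_cases hle : content i ≤ α
  · by_cases heq : content i = α
    · rw [if_pos heq, heq, tsub_self, if_pos rfl, one_smul, mdesc_self]
    · have hne : α - content i ≠ 0 := fun h0 =>
        heq (le_antisymm hle (tsub_eq_zero_iff_le.1 h0))
      rw [if_neg heq, if_neg hne, zero_smul, smul_zero, smul_zero]
  · have heq : content i ≠ α := fun h0 => hle h0.le
    rw [mdesc_eq_zero_of_not_le hi hle, if_neg heq, Nat.cast_zero, zero_smul, smul_zero]

lemma IsSymm.apply_eq_of_content_eq {n : ℕ} {f : Tensor ι X n} (hf : IsSymm f) {i i' : Fin n → ι}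
    (h : content i = content i') : f i = f i' := by
  obtain ⟨σ, rfl⟩ := exists_perm_of_content_eq h
  exact hf σ i'

/-- All `n!/α!` summands are equal, so `α!` cancels; the remaining `n!` is what the normalization
`1/n!` removes. -/
lemma IsSymm.sum_words {n : ℕ} {f : Tensor ι X n} (hf : IsSymm f) (i : Fin n → ι) :
    (mfact (content i) : ℝ) • ∑ j ∈ words n (content i), f j = (n.factorial : ℝ) • f i := by
  have h : ∑ j ∈ words n (content i), f j = ∑ j ∈ words n (content i), f i :=
    Finset.sum_congr rfl fun j hj => hf.apply_eq_of_content_eq (mem_words.1 hj)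
  rw [h, Finset.sum_const, ← Nat.cast_smul_eq_nsmul ℝ, smul_smul,
    ← card_words_mul_mfact n (content i) (degree_content i)]
  push_cast
  rw [mul_comm]

/-! ### Existence of the iterated integrals -/

lemma memLp_hermTensor [IsFiniteMeasure P] (hW : IsWhiteNoise W P) {E : Type*}
    [NormedAddCommGroup E] [NormedSpace ℝ E] (β : ι →₀ ℕ) (x : E) :
    MemLp (fun ω => herm u W β ω • x) 2 P :=
  ((ContinuousLinearMap.id ℝ ℝ).smulRight x).comp_memLp' (memLp_herm (u := u) hW β 2 (by norm_num))

open Classical in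
-- This is integration by parts read as an adjoint relation. Only entry `i`, and there only the
-- letter `k`, gives a nonzero contribution.
lemma isSkorokhod_hermTensor [IsProbabilityMeasure P] [CompleteSpace X] (hW : IsWhiteNoise W P)
    {n : ℕ} (β : ι →₀ ℕ) (i : Fin n → ι) (k : ι) (x : X) :
    IsSkorokhod P W u
      ((memLp_hermTensor (u := u) hW β
        (lp.single 2 (Fin.snoc i k : Fin (n + 1) → ι) x : Tensor ι X (n + 1))).toLp _)
      ((memLp_hermTensor (u := u) hW (β + Finsupp.single k 1)
        (lp.single 2 i x : Tensor ι X n)).toLp _) := by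
  intro p hp j
  have e1 := (memLp_hermTensor (u := u) hW β
        (lp.single 2 (Fin.snoc i k : Fin (n + 1) → ι) x : Tensor ι X (n + 1))).coeFn_toLp
  have e2 := (memLp_hermTensor (u := u) hW (β + Finsupp.single k 1)
        (lp.single 2 i x : Tensor ι X n)).coeFn_toLp
  by_cases hji : j = i
  · subst hji
    have hk : ∫ ω, inner ℝ (u k) (p.2 ω) • ((memLp_hermTensor (u := u) hW β
        (lp.single 2 (Fin.snoc j k : Fin (n + 1) → ι) x : Tensor ι X (n + 1))).toLp _ : Ω → _) ω
          (Fin.snoc j k : Fin (n + 1) → ι) ∂P =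
        ∫ ω, p.1 ω • ((memLp_hermTensor (u := u) hW (β + Finsupp.single k 1)
        (lp.single 2 j x : Tensor ι X n)).toLp _ : Ω → _) ω j ∂P := by
      have l : ∫ ω, inner ℝ (u k) (p.2 ω) • ((memLp_hermTensor (u := u) hW β
          (lp.single 2 (Fin.snoc j k : Fin (n + 1) → ι) x : Tensor ι X (n + 1))).toLp _ : Ω → _) ω
            (Fin.snoc j k : Fin (n + 1) → ι) ∂P =
          (∫ ω, inner ℝ (u k) (p.2 ω) * herm u W β ω ∂P) • x := by
        rw [← integral_smul_const]
        refine integral_congr_ae ?_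
        filter_upwards [e1] with ω e1
        rw [e1, lp.coeFn_smul, Pi.smul_apply, lp.single_apply_self, mul_smul]
      rw [l, ← integral_mul_herm_add_single hW hp, ← integral_smul_const]
      refine integral_congr_ae ?_
      filter_upwards [e2] with ω e2
      rw [e2, lp.coeFn_smul, Pi.smul_apply, lp.single_apply_self, mul_smul]
    rw [← hk]
    refine hasSum_single k fun l hl => integral_eq_zero_of_ae ?_
    filter_upwards [e1] with ω e1
    have hne : (Fin.snoc j l : Fin (n + 1) → ι) ≠ Fin.snoc j k := fun h =>
      hl (Fin.snoc_right_injective (α := fun _ => ι) j h)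
    rw [e1, lp.coeFn_smul, Pi.smul_apply, lp.single_apply_ne _ _ _ hne, smul_zero, smul_zero,
      Pi.zero_apply]
  · have h0 : ∫ ω, p.1 ω • ((memLp_hermTensor (u := u) hW (β + Finsupp.single k 1)
        (lp.single 2 i x : Tensor ι X n)).toLp _ : Ω → _) ω j ∂P = 0 := by
      refine integral_eq_zero_of_ae ?_
      filter_upwards [e2] with ω e2
      rw [e2, lp.coeFn_smul, Pi.smul_apply, lp.single_apply_ne _ _ _ hji, smul_zero, smul_zero,
        Pi.zero_apply]
    rw [h0]
    convert hasSum_zero with l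
    refine integral_eq_zero_of_ae ?_
    filter_upwards [e1] with ω e1
    have hne : (Fin.snoc j l : Fin (n + 1) → ι) ≠ Fin.snoc i k := fun h =>
      hji (Fin.snoc_injective2 (α := fun _ => ι) h).1
    rw [e1, lp.coeFn_smul, Pi.smul_apply, lp.single_apply_ne _ _ _ hne, smul_zero, smul_zero,
      Pi.zero_apply]

open Classical in
-- The index `β` stays arbitrary because each step of the induction moves the last letter into it.
-- Deterministic tensors are the case `β = 0`.
lemma isSkorokhodIter_hermTensor [IsProbabilityMeasure P] [CompleteSpace X]
    (hW : IsWhiteNoise W P) {n : ℕ} (β : ι →₀ ℕ) (i : Fin n → ι) (x : X) :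
    IsSkorokhodIter P W u n
      ((memLp_hermTensor (u := u) hW β (lp.single 2 i x : Tensor ι X n)).toLp _)
      ((memLp_hermTensor (u := u) hW (β + content i) x).toLp _) := by
  induction n generalizing β with
  | zero =>
    simp only [IsSkorokhodIter]
    filter_upwards [(memLp_hermTensor (u := u) hW β (lp.single 2 i x : Tensor ι X 0)).coeFn_toLp,
      (memLp_hermTensor (u := u) hW (β + content i) x).coeFn_toLp] with ω h1 h2
    have hi : i = Fin.elim0 := Subsingleton.elim _ _
    rw [h1, h2, lp.coeFn_smul, Pi.smul_apply, content_of_isEmpty, add_zero, hi,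
      lp.single_apply_self]
  | succ n ih =>
    obtain ⟨i', k, rfl⟩ : ∃ (i' : Fin n → ι) (k : ι), i = Fin.snoc i' k :=
      ⟨Fin.init i, i (Fin.last n), (Fin.snoc_init_self i).symm⟩
    refine ⟨_, isSkorokhod_hermTensor hW β i' k x, ?_⟩
    have := ih (β + Finsupp.single k 1) i'
    rwa [add_assoc, add_comm (Finsupp.single k 1), ← content_snoc] at this

open Classical in
lemma exists_isSkorokhodIter_single [IsProbabilityMeasure P] [CompleteSpace X]
    (hW : IsWhiteNoise W P) {n : ℕ} (i : Fin n → ι) (x : X) :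
    ∃ g, IsSkorokhodIter P W u n (Lp.const 2 P (lp.single 2 i x : Tensor ι X n)) g := by
  refine ⟨(memLp_hermTensor (u := u) hW (0 + content i) x).toLp _, ?_⟩
  convert isSkorokhodIter_hermTensor (u := u) hW 0 i x
  refine Lp.ext ?_
  filter_upwards [(memLp_hermTensor (u := u) hW 0 (lp.single 2 i x : Tensor ι X n)).coeFn_toLp,
    Lp.coeFn_const (p := 2) (μ := P) (lp.single 2 i x : Tensor ι X n)] with ω h1 h2
  rw [h1, h2, herm_zero, one_smul, Function.const_apply]

open Classical in
/-- The symmetrization `∑ x ⊗ u_{i₁} ⊗ ⋯ ⊗ u_{iₙ}` over the words `i` of content `α`. -/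
def symTensor (n : ℕ) (α : ι →₀ ℕ) (x : X) : Tensor ι X n := ∑ i ∈ words n α, lp.single 2 i x

open Classical in
lemma symTensor_apply (n : ℕ) (α : ι →₀ ℕ) (x : X) (j : Fin n → ι) :
    symTensor n α x j = if content j = α then x else 0 := by
  rw [symTensor, lp.coeFn_sum, Finset.sum_apply]
  split_ifs with h
  · rw [Finset.sum_eq_single j]
    · exact lp.single_apply_self ..
    · intro i _ hi
      exact lp.single_apply_ne _ _ _ hi.symm
    · intro hj
      exact absurd (mem_words.2 h) hj
  · refine Finset.sum_eq_zero fun i hi => lp.single_apply_ne _ _ _ ?_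
    rintro rfl
    exact h (mem_words.1 hi)

lemma isSymm_symTensor (n : ℕ) (α : ι →₀ ℕ) (x : X) : IsSymm (symTensor n α x) := by
  classical
  intro σ i
  rw [symTensor_apply, symTensor_apply, content_comp_perm]

lemma symTensor_mem_domain (q : ι → ℝ) (r : ℝ) (n : ℕ) (α : ι →₀ ℕ) (x : X) :
    symTensor n α x ∈ (lambdaQ X q r n).domain := by
  classical
  change Memℓp (fun i : Fin n → ι => (∏ j, q (i j) ^ r) • symTensor n α x i) 2
  refine (memℓp_zero ?_).of_exponent_ge zero_le
  refine (words n α).finite_toSet.subset fun i hi => ?_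
  by_contra hc
  refine hi ?_
  rw [symTensor_apply, if_neg fun h => hc (Finset.mem_coe.2 (mem_words.2 h)), smul_zero]

lemma exists_isSkorokhodIter_symTensor [IsProbabilityMeasure P] [CompleteSpace X]
    (hW : IsWhiteNoise W P) (n : ℕ) (α : ι →₀ ℕ) (x : X) :
    ∃ g, IsSkorokhodIter P W u n (Lp.const 2 P (symTensor n α x)) g := by
  classical
  rw [symTensor]
  refine Finset.sum_induction _
    (fun f : Tensor ι X n => ∃ g, IsSkorokhodIter P W u n (Lp.const 2 P f) g) ?_ ?_ ?_
  · rintro f f' ⟨g, hg⟩ ⟨g', hg'⟩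
    exact ⟨g + g', by rw [map_add]; exact hg.add hg'⟩
  · exact ⟨0, by rw [map_zero]; exact IsSkorokhodIter.zero n⟩
  · intro i _
    exact exists_isSkorokhodIter_single hW i x

/-! ### Cameron-Martin coefficients and the norm of simple elements -/

/-- The weight `q^{2 r α} / |α|!`. -/
def weight (q : ι → ℝ) (r : ℝ) (α : ι →₀ ℕ) : ℝ :=
  1 / (α.degree.factorial : ℝ) * qPow q (2 * r) α

lemma qPow_pos {q : ι → ℝ} (hq : ∀ k, 0 < q k) (s : ℝ) (α : ι →₀ ℕ) : 0 < qPow q s α :=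
  Finset.prod_pos fun k _ => Real.rpow_pos_of_pos (hq k) _

lemma weight_pos {q : ι → ℝ} (hq : ∀ k, 0 < q k) (r : ℝ) (α : ι →₀ ℕ) : 0 < weight q r α :=
  mul_pos (by positivity) (qPow_pos hq _ α)

lemma qPow_add {q : ι → ℝ} (hq : ∀ k, 0 < q k) (s : ℝ) (α β : ι →₀ ℕ) :
    qPow q s (α + β) = qPow q s α * qPow q s β := by
  classical
  refine Finsupp.prod_add_index' (fun k => by simp) fun k m n => ?_
  rw [Nat.cast_add, mul_add, Real.rpow_add (hq k)]

lemma sq_prod_rpow {q : ι → ℝ} (hq : ∀ k, 0 < q k) (r : ℝ) {n : ℕ} (i : Fin n → ι) :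
    (∏ j, q (i j) ^ r) ^ 2 = qPow q (2 * r) (content i) := by
  induction n with
  | zero => simp [content_of_isEmpty, qPow]
  | succ n ih =>
    have h := ih (Fin.init i)
    have hi : content i = content (Fin.init i) + Finsupp.single (i (Fin.last n)) 1 := by
      rw [← content_snoc, Fin.snoc_init_self i]
    rw [Fin.prod_univ_castSucc, mul_pow, hi, qPow_add hq, ← h]
    congr 1
    rw [qPow, Finsupp.prod_single_index (by simp), Nat.cast_one, mul_one, ← Real.rpow_natCast,
      ← Real.rpow_mul (hq _).le]
    congr 1
    push_cast
    ring

lemma xi_smul_eq (α : ι →₀ ℕ) (g : Ω → X) (ω : Ω) :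
    xi u W α ω • g ω = (√(mfact α : ℝ))⁻¹ • (herm u W α ω • g ω) := by
  rw [xi_eq_herm, smul_smul, div_eq_inv_mul]

lemma memLp_xi [IsFiniteMeasure P] (hW : IsWhiteNoise W P) (α : ι →₀ ℕ) : MemLp (xi u W α) 2 P := by
  have h : xi u W α = fun ω => herm u W α ω / √(mfact α : ℝ) := funext (xi_eq_herm α)
  have hm := (memLp_herm (u := u) hW α 2 (by norm_num)).const_mul (√(mfact α : ℝ))⁻¹
  simpa only [h, div_eq_inv_mul] using hm

lemma integrable_xi_smul [IsFiniteMeasure P] (hW : IsWhiteNoise W P) (α : ι →₀ ℕ)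
    (g : Lp X 2 P) : Integrable (fun ω => xi u W α ω • g ω) P :=
  memLp_one_iff_integrable.1 ((Lp.memLp g).smul (memLp_xi hW α))

namespace Simple

variable {q : ι → ℝ} {r : ℝ} [IsProbabilityMeasure P]

/-- The Cameron-Martin coefficient `E (ξ_α g)`. -/
def coeff (p : Simple P W u q r X) (α : ι →₀ ℕ) : X := ∫ ω, xi u W α ω • p.rv ω ∂P

lemma coeff_add (hW : IsWhiteNoise W P) (p p' : Simple P W u q r X) (α : ι →₀ ℕ) :
    (p + p').coeff α = p.coeff α + p'.coeff α := by
  rw [coeff, coeff, coeff, ← integral_add (integrable_xi_smul hW α _) (integrable_xi_smul hW α _)]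
  refine integral_congr_ae ?_
  have h : (p + p').rv = p.rv + p'.rv := rfl
  filter_upwards [Lp.coeFn_add p.rv p'.rv] with ω hω
  rw [h, hω, Pi.add_apply, smul_add]

/-- `E (ξ_α g) = f_α / √α!`, where `f` is the kernel of order `|α|`. -/
lemma coeff_content [CompleteSpace X] (hW : IsWhiteNoise W P) (p : Simple P W u q r X)
    {n : ℕ} (i : Fin n → ι) :
    p.coeff (content i) = (√(mfact (content i) : ℝ))⁻¹ • p.1.2 n i := by
  obtain ⟨hsymm, -, s, hs, hg⟩ := p.2
  have hrv : p.rv = ∑ k ∈ s.support, (1 / (k.factorial : ℝ)) • s k := hg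
  have hint : ∀ k, Integrable (fun ω => herm u W (content i) ω • s k ω) P := fun k =>
    memLp_one_iff_integrable.1 ((Lp.memLp (s k)).smul (memLp_herm hW _ 2 (by norm_num)))
  have h1 : ∫ ω, herm u W (content i) ω • p.rv ω ∂P =
      ∑ k ∈ s.support, (1 / (k.factorial : ℝ)) • ∫ ω, herm u W (content i) ω • s k ω ∂P := by
    simp only [← integral_smul]
    rw [← integral_finsetSum _ fun k _ => (hint k).fun_smul _]
    refine integral_congr_ae ?_
    have hsm := (ae_ball_iff s.support.countable_toSet).2 fun k _ =>
      Lp.coeFn_smul (1 / (k.factorial : ℝ)) (s k)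
    filter_upwards [Lp.coeFn_finsetSum s.support fun k => (1 / (k.factorial : ℝ)) • s k, hsm]
      with ω hω hω'
    rw [hrv, hω, Finset.sum_apply, Finset.smul_sum]
    refine Finset.sum_congr rfl fun k hk => ?_
    rw [hω' k hk, Pi.smul_apply, smul_comm]
  -- Orthogonality of the chaoses: no word of length `k` has a content of degree `n`.
  have h2 : ∀ k ≠ n, ∫ ω, herm u W (content i) ω • s k ω ∂P = 0 := by
    intro k hk
    rw [integral_herm_smul_of_isSkorokhodIter_const hW (hs k),
      words_eq_empty (by rw [degree_content]; exact hk.symm), Finset.sum_empty, smul_zero]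
  have h3 : ∫ ω, herm u W (content i) ω • p.rv ω ∂P =
      (1 / (n.factorial : ℝ)) • ∫ ω, herm u W (content i) ω • s n ω ∂P := by
    rw [h1, Finset.sum_eq_single n]
    · intro k _ hk
      rw [h2 k hk, smul_zero]
    · intro hn
      rw [Finsupp.notMem_support_iff.1 hn]
      refine smul_eq_zero_of_right _ (integral_eq_zero_of_ae ?_)
      filter_upwards [Lp.coeFn_zero X 2 P] with ω hω
      simp only [hω, Pi.zero_apply, smul_zero]
  have hn : (n.factorial : ℝ) ≠ 0 := by positivity
  simp only [coeff, xi_smul_eq]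
  rw [integral_smul, h3, integral_herm_smul_of_isSkorokhodIter_const hW (hs n),
    (hsymm n).sum_words, smul_smul (1 / (n.factorial : ℝ)), one_div_mul_cancel hn, one_smul]

/-- The squared norm of a simple element in terms of its Cameron-Martin coefficients. -/
lemma hasSum_weight_mul_coeff [CompleteSpace X] (hW : IsWhiteNoise W P) (hq : ∀ k, 0 < q k)
    (p : Simple P W u q r X) :
    HasSum (fun α => weight q r α * ‖p.coeff α‖ ^ 2) (‖p‖ ^ 2) := by
  -- One nonnegative family over the words of all lengths. Summed by length it gives the norm, and
  -- summed by content the weighted coefficients.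
  set T : (Σ n : ℕ, Fin n → ι) → ℝ := fun s =>
    1 / (s.1.factorial : ℝ) ^ 2 * (qPow q (2 * r) (content s.2) * ‖p.1.2 s.1 s.2‖ ^ 2) with hT
  have hT0 : ∀ s, 0 ≤ T s := fun s => by
    have := qPow_pos hq (2 * r) (content s.2)
    simp only [hT]
    positivity
  have hin : ∀ n, HasSum (fun i : Fin n → ι => T ⟨n, i⟩) (‖p.toLp n‖ ^ 2) := by
    intro n
    have h := lp.hasSum_norm (p := 2) (by norm_num) (p.lambdaKernel n)
    simp only [ENNReal.toReal_ofNat, Real.rpow_ofNat] at h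
    have h' := h.mul_left (1 / (n.factorial : ℝ) ^ 2)
    have e : ‖p.toLp n‖ ^ 2 = 1 / (n.factorial : ℝ) ^ 2 * ‖p.lambdaKernel n‖ ^ 2 := by
      change ‖(1 / (n.factorial : ℝ)) • p.lambdaKernel n‖ ^ 2 = _
      rw [norm_smul, mul_pow, Real.norm_eq_abs, sq_abs, div_pow, one_pow]
    rw [e]
    refine h'.congr_fun fun i => ?_
    have e2 : p.lambdaKernel n i = (∏ j, q (i j) ^ r) • p.1.2 n i := rfl
    rw [e2, norm_smul, mul_pow, Real.norm_eq_abs, sq_abs, sq_prod_rpow hq]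
  have hout : HasSum (fun n => ‖p.toLp n‖ ^ 2) (‖p‖ ^ 2) := by
    have h := lp.hasSum_norm (p := 2) (by norm_num) p.toLp
    simp only [ENNReal.toReal_ofNat, Real.rpow_ofNat] at h
    have e : ‖p‖ = ‖p.toLp‖ := p.normQ_eq
    rwa [e]
  have hsum : Summable T := by
    refine (summable_sigma_of_nonneg hT0).2 ⟨fun n => (hin n).summable, ?_⟩
    simp only [(hin _).tsum_eq]
    exact hout.summable
  have htot : HasSum T (‖p‖ ^ 2) := by
    have h := hsum.hasSum.sigma hin
    rw [← h.unique hout]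
    exact hsum.hasSum
  set c : (Σ n : ℕ, Fin n → ι) → ι →₀ ℕ := fun s => content s.2 with hc
  have htot' := (Equiv.sigmaFiberEquiv c).hasSum_iff.2 htot
  refine htot'.sigma fun α => ?_
  -- The fibre of `content` over `α` is finite, since all its words have length `|α|`.
  set F : Finset (Σ n : ℕ, Fin n → ι) :=
    (words α.degree α).map ⟨Sigma.mk α.degree, sigma_mk_injective⟩ with hF
  have hfib : (F : Set (Σ n : ℕ, Fin n → ι)) = {s | c s = α} := by
    ext ⟨n, i⟩
    simp only [hF, Finset.coe_map, Set.mem_image, Finset.mem_coe, mem_words]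
    constructor
    · rintro ⟨j, hj, hji⟩
      have : c ⟨n, i⟩ = c ⟨α.degree, j⟩ := congrArg c hji.symm
      exact this.trans hj
    · intro h
      have h' : content i = α := h
      have hn : α.degree = n := by rw [← h', degree_content]
      subst hn
      exact ⟨i, h', rfl⟩
  obtain ⟨i₀, hi₀⟩ := words_nonempty α
  -- With `n = |α|`, the `n!/α!` equal terms carry `1/n!²`, and `‖f_α‖² = α! ‖p.coeff α‖²`; what
  -- remains is `1/n!`.
  have hval : ∑ s ∈ F, T s = weight q r α * ‖p.coeff α‖ ^ 2 := by
    have hcst : ∀ i ∈ words α.degree α, T ⟨α.degree, i⟩ =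
        1 / (α.degree.factorial : ℝ) ^ 2 *
          (qPow q (2 * r) α * ‖p.1.2 α.degree i₀‖ ^ 2) := by
      intro i hi
      simp only [hT]
      rw [mem_words.1 hi, (p.2.1 _).apply_eq_of_content_eq
        ((mem_words.1 hi).trans (mem_words.1 hi₀).symm)]
    have hco : p.coeff α = (√(mfact α : ℝ))⁻¹ • p.1.2 α.degree i₀ := by
      have := p.coeff_content hW i₀
      rwa [mem_words.1 hi₀] at this
    have hcard : ((words α.degree α).card : ℝ) * (mfact α : ℝ) = α.degree.factorial := by
      exact_mod_cast card_words_mul_mfact α.degree α rfl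
    have hm : (0 : ℝ) < mfact α := by exact_mod_cast mfact_pos α
    have hf : (0 : ℝ) < α.degree.factorial := by positivity
    rw [Finset.sum_map]
    simp only [Function.Embedding.coeFn_mk]
    rw [Finset.sum_congr rfl hcst, Finset.sum_const, nsmul_eq_mul, hco, norm_smul, mul_pow,
      norm_inv, Real.norm_eq_abs, inv_pow, sq_abs, Real.sq_sqrt hm.le, weight,
      eq_div_of_mul_eq hm.ne' hcard]
    field_simp
  rw [← hval]
  have h := Finset.hasSum F T
  rw [hfib] at h
  exact h

/-! ### Dense isometric embedding of the simple elements into `ℓ²` -/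

lemma memℓp_coeff [CompleteSpace X] (hW : IsWhiteNoise W P) (hq : ∀ k, 0 < q k)
    (p : Simple P W u q r X) : Memℓp (fun α => √(weight q r α) • p.coeff α) 2 := by
  refine memℓp_gen ?_
  simp only [ENNReal.toReal_ofNat, Real.rpow_ofNat]
  refine (p.hasSum_weight_mul_coeff hW hq).summable.congr fun α => ?_
  rw [norm_smul, mul_pow, Real.norm_eq_abs, sq_abs, Real.sq_sqrt (weight_pos hq r α).le]

/-- The chaos coefficients, weighted by `√(q^{2 r α} / |α|!)`. -/
def coeffHom [CompleteSpace X] (hW : IsWhiteNoise W P) (hq : ∀ k, 0 < q k) :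
    Simple P W u q r X →+ lp (fun _ : ι →₀ ℕ => X) 2 :=
  AddMonoidHom.mk' (fun p => ⟨_, p.memℓp_coeff hW hq⟩) fun p p' => by
    ext α
    change √(weight q r α) • (p + p').coeff α = _ + _
    rw [coeff_add hW, smul_add]

lemma coeffHom_apply [CompleteSpace X] (hW : IsWhiteNoise W P) (hq : ∀ k, 0 < q k)
    (p : Simple P W u q r X) (α : ι →₀ ℕ) :
    coeffHom hW hq p α = √(weight q r α) • p.coeff α := rfl

lemma norm_sq_eq_tsum (v : lp (fun _ : ι →₀ ℕ => X) 2) : ‖v‖ ^ 2 = ∑' α, ‖v α‖ ^ 2 := by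
  have h := lp.norm_rpow_eq_tsum (p := 2) (by norm_num) v
  simpa only [ENNReal.toReal_ofNat, Real.rpow_ofNat] using h

lemma isometry_coeffHom [CompleteSpace X] (hW : IsWhiteNoise W P) (hq : ∀ k, 0 < q k) :
    Isometry (coeffHom hW hq : Simple P W u q r X →+ lp (fun _ : ι →₀ ℕ => X) 2) := by
  refine AddMonoidHomClass.isometry_of_norm _ fun p => ?_
  rw [← sq_eq_sq₀ (norm_nonneg _) (norm_nonneg _), norm_sq_eq_tsum,
    ← (p.hasSum_weight_mul_coeff hW hq).tsum_eq]
  refine tsum_congr fun α => ?_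
  rw [coeffHom_apply, norm_smul, mul_pow, Real.norm_eq_abs, sq_abs,
    Real.sq_sqrt (weight_pos hq r α).le]

lemma exists_coeff_eq_single [CompleteSpace X] (hW : IsWhiteNoise W P) (α : ι →₀ ℕ) (x : X) :
    ∃ p : Simple P W u q r X, p.coeff α = x ∧ ∀ β ≠ α, p.coeff β = 0 := by
  classical
  set n := α.degree with hn
  -- The scaling compensates the factor `1/√α!` in `coeff_content`.
  set y : X := √(mfact α : ℝ) • x with hy
  obtain ⟨g, hg⟩ := exists_isSkorokhodIter_symTensor (u := u) hW n α y
  have hmem : ((1 / (n.factorial : ℝ)) • g, DFinsupp.single n (symTensor n α y)) ∈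
      simpleSubmodule P W u q r X := by
    refine ⟨fun k => ?_, fun k => ?_, Finsupp.single n g, fun k => ?_, ?_⟩
    · rcases eq_or_ne n k with rfl | hk
      · rw [DFinsupp.single_eq_same]
        exact isSymm_symTensor n α y
      · rw [DFinsupp.single_eq_of_ne hk.symm]
        intro σ i
        simp
    · rcases eq_or_ne n k with rfl | hk
      · rw [DFinsupp.single_eq_same]
        exact symTensor_mem_domain q r n α y
      · rw [DFinsupp.single_eq_of_ne hk.symm]
        exact Submodule.zero_mem _
    · rcases eq_or_ne n k with rfl | hk
      · rw [DFinsupp.single_eq_same, Finsupp.single_eq_same]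
        exact hg
      · rw [DFinsupp.single_eq_of_ne hk.symm, Finsupp.single_eq_of_ne hk.symm, map_zero]
        exact IsSkorokhodIter.zero k
    · rw [Finsupp.sum_single_index (by simp)]
  have hco : ∀ β, coeff (⟨_, hmem⟩ : Simple P W u q r X) β =
      if β = α then x else 0 := by
    intro β
    obtain ⟨i, hi⟩ := words_nonempty β
    rw [mem_words] at hi
    have h := coeff_content hW (⟨_, hmem⟩ : Simple P W u q r X) i
    rw [hi] at h
    rw [h]
    have hm : √(mfact α : ℝ) ≠ 0 := by
      have : (0 : ℝ) < mfact α := by exact_mod_cast mfact_pos α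
      positivity
    by_cases hβ : β = α
    · subst hβ
      have hk : (DFinsupp.single n (symTensor n β y) : Π₀ k, Tensor ι X k) β.degree i = y := by
        rw [hn, DFinsupp.single_eq_same, symTensor_apply, if_pos hi]
      refine (congrArg _ hk).trans ?_
      rw [if_pos rfl, hy, smul_smul, inv_mul_cancel₀ hm, one_smul]
    · rw [if_neg hβ]
      refine smul_eq_zero_of_right _ ?_
      change (DFinsupp.single n (symTensor n α y) : Π₀ k, Tensor ι X k) β.degree i = 0
      rcases eq_or_ne n β.degree with h | h
      -- The type of `i` depends on `β.degree`, so the length is generalized before being identified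
      -- with `n`.
      · have key : ∀ (m : ℕ) (i : Fin m → ι), content i = β → n = m →
            (DFinsupp.single n (symTensor n α y) : Π₀ k, Tensor ι X k) m i = 0 := by
          rintro m i hi rfl
          rw [DFinsupp.single_eq_same, symTensor_apply, if_neg (hi ▸ hβ)]
        exact key _ i hi h
      · rw [DFinsupp.single_eq_of_ne h.symm]
        rfl
  exact ⟨⟨_, hmem⟩, by rw [hco, if_pos rfl], fun β hβ => by rw [hco, if_neg hβ]⟩

/-- Finitely supported families are dense in `ℓ²`, and the range is a subgroup containing every
family with one nonzero entry. -/
lemma denseRange_coeffHom [CompleteSpace X] (hW : IsWhiteNoise W P) (hq : ∀ k, 0 < q k) :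
    DenseRange (coeffHom hW hq : Simple P W u q r X →+ lp (fun _ : ι →₀ ℕ => X) 2) := by
  classical
  intro v
  refine mem_closure_of_tendsto (lp.hasSum_single (p := 2) (by norm_num) v)
    (Eventually.of_forall fun s => ?_)
  change _ ∈ AddMonoidHom.range (coeffHom hW hq : Simple P W u q r X →+ _)
  refine AddSubgroup.sum_mem _ fun α _ => ?_
  have hw : √(weight q r α) ≠ 0 := (Real.sqrt_pos.2 (weight_pos hq r α)).ne'
  obtain ⟨p, hp, hp'⟩ := exists_coeff_eq_single (u := u) (q := q) (r := r) hW α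
    ((√(weight q r α))⁻¹ • v α)
  refine ⟨p, ?_⟩
  ext β
  rw [coeffHom_apply]
  rcases eq_or_ne β α with rfl | hβ
  · rw [hp, smul_smul, mul_inv_cancel₀ hw, one_smul]
    exact (lp.single_apply_self (E := fun _ : ι →₀ ℕ => X) 2 β (v β)).symm
  · rw [hp' β hβ, smul_zero]
    exact (lp.single_apply_ne (E := fun _ : ι →₀ ℕ => X) 2 α (v α) hβ).symm

end Simple

/-! ### The isometry with a weighted `ℓ²` space -/

namespace LSpace

variable {q : ι → ℝ} {r : ℝ} [IsProbabilityMeasure P] [CompleteSpace X]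

/-- The extension of `Simple.coeffHom` to `(L)_{Q,r}(Ω; X)`. -/
def coeffs (hW : IsWhiteNoise W P) (hq : ∀ k, 0 < q k) (x : LSpace P W u q r X) :
    lp (fun _ : ι →₀ ℕ => X) 2 :=
  UniformSpace.Completion.extension (Simple.coeffHom hW hq) x

variable (hW : IsWhiteNoise W P) (hq : ∀ k, 0 < q k)

lemma coeffs_coe (p : Simple P W u q r X) :
    coeffs hW hq (p : LSpace P W u q r X) = Simple.coeffHom hW hq p :=
  UniformSpace.Completion.extension_coe (Simple.isometry_coeffHom hW hq).uniformContinuous p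

lemma isometry_coeffs : Isometry (coeffs hW hq : LSpace P W u q r X → _) :=
  (Simple.isometry_coeffHom hW hq).completion_extension

lemma norm_coeffs (x : LSpace P W u q r X) : ‖coeffs hW hq x‖ = ‖x‖ := by
  have h0 : coeffs hW hq (0 : LSpace P W u q r X) = 0 := by
    rw [← UniformSpace.Completion.coe_zero, coeffs_coe, map_zero]
  rw [← dist_zero_right, ← h0, (isometry_coeffs hW hq).dist_eq, dist_zero_right]

/-- The isometric image of a complete space is closed, and this one is dense. -/
lemma surjective_coeffs : Function.Surjective (coeffs hW hq : LSpace P W u q r X → _) := by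
  have hcl := (isometry_coeffs (u := u) (r := r) (X := X) hW hq).isClosedEmbedding.isClosed_range
  have hd : DenseRange (coeffs hW hq : LSpace P W u q r X → _) := by
    refine (Simple.denseRange_coeffHom (u := u) (r := r) hW hq).mono ?_
    rintro _ ⟨p, rfl⟩
    exact ⟨p, coeffs_coe hW hq p⟩
  exact Set.range_eq_univ.1 (hcl.closure_eq ▸ hd.closure_range)

/-- Entries depend continuously on a point of `ℓ²` and the weights are positive. Convergence to `x`
therefore forces every `E(g_m ξ_α)` to converge, to a limit fixed by `x`. -/
lemma isFormalSeries_iff (x : LSpace P W u q r X) (η : (ι →₀ ℕ) → X) :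
    IsFormalSeries x η ↔ ∀ α, coeffs hW hq x α = √(weight q r α) • η α := by
  have hconv : ∀ g : ℕ → Simple P W u q r X,
      Tendsto (fun m => (g m : LSpace P W u q r X)) atTop (𝓝 x) → ∀ α,
        Tendsto (fun m => √(weight q r α) • (g m).coeff α) atTop (𝓝 (coeffs hW hq x α)) := by
    intro g hg α
    have h := ((isometry_coeffs hW hq).continuous.tendsto x).comp hg
    have h2 := ((lp.evalCLM ℝ (fun _ : ι →₀ ℕ => X) 2 α).continuous.tendsto _).comp h
    refine h2.congr fun m => ?_
    simp only [Function.comp_apply, coeffs_coe]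
    rfl
  constructor
  · rintro ⟨g, hg, hη⟩ α
    exact tendsto_nhds_unique (hconv g hg α) ((hη α).const_smul _)
  · intro h
    -- Any sequence of simple elements tending to `x` will do; density supplies one.
    obtain ⟨y, hy, hyx⟩ := mem_closure_iff_seq_limit.1
      ((UniformSpace.Completion.denseRange_coe (α := Simple P W u q r X)) x)
    choose g hg using hy
    have hgx : Tendsto (fun m => (g m : LSpace P W u q r X)) atTop (𝓝 x) := by
      simpa only [hg] using hyx
    refine ⟨g, hgx, fun α => ?_⟩
    have hw : √(weight q r α) ≠ 0 := (Real.sqrt_pos.2 (weight_pos hq r α)).ne'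
    have hα := (hconv g hgx α).const_smul (√(weight q r α))⁻¹
    rw [h α] at hα
    simp only [smul_smul, inv_mul_cancel₀ hw, one_smul] at hα
    exact hα

end LSpace

end GaussianChaos
end

/-! ### The summability criterion and the norm identity -/

theorem theorem3p1 {Ω : Type*} [MeasurableSpace Ω] (P : MeasureTheory.Measure Ω)
    [MeasureTheory.IsProbabilityMeasure P]
    {U : Type*} [NormedAddCommGroup U] [InnerProductSpace ℝ U] [CompleteSpace U]
    [TopologicalSpace.SeparableSpace U]
    {X : Type*} [NormedAddCommGroup X] [InnerProductSpace ℝ X] [CompleteSpace X]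
    [TopologicalSpace.SeparableSpace X]
    (W : U → Ω → ℝ) (hW : GaussianChaos.IsWhiteNoise W P)
    (hgen : GaussianChaos.GeneratesMod W P)
    {ι : Type*} (u : HilbertBasis ι ℝ U)
    (q : ι → ℝ) (hq : ∀ k, 1 ≤ q k) (r : ℝ) (η : (ι →₀ ℕ) → X) :
    ((∃ x : GaussianChaos.LSpace P W u q r X, GaussianChaos.IsFormalSeries x η) ↔
      Summable fun α : ι →₀ ℕ =>
        1 / (α.degree.factorial : ℝ) * GaussianChaos.qPow q (2 * r) α * ‖η α‖ ^ 2) ∧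
    (∀ x : GaussianChaos.LSpace P W u q r X, GaussianChaos.IsFormalSeries x η →
      ‖x‖ ^ 2 = ∑' α : ι →₀ ℕ,
        1 / (α.degree.factorial : ℝ) * GaussianChaos.qPow q (2 * r) α * ‖η α‖ ^ 2) := by
  have hq0 : ∀ k, 0 < q k := fun k => one_pos.trans_le (hq k)
  have hnorm : ∀ α : ι →₀ ℕ, ‖√(GaussianChaos.weight q r α) • η α‖ ^ 2 =
      1 / (α.degree.factorial : ℝ) * GaussianChaos.qPow q (2 * r) α * ‖η α‖ ^ 2 := fun α => by
    rw [norm_smul, mul_pow, Real.norm_eq_abs, sq_abs,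
      Real.sq_sqrt (GaussianChaos.weight_pos hq0 r α).le, GaussianChaos.weight]
  -- Both claims now concern the family `√(weight q r α) • η α`: its membership in `ℓ²` and its norm
  -- there.
  simp only [GaussianChaos.LSpace.isFormalSeries_iff hW hq0, ← hnorm]
  refine ⟨⟨?_, fun hs => ?_⟩, fun x hx => ?_⟩
  · rintro ⟨x, hx⟩
    have h := (lp.memℓp (GaussianChaos.LSpace.coeffs hW hq0 x)).summable (by norm_num)
    simpa only [ENNReal.toReal_ofNat, Real.rpow_ofNat, hx] using h
  · have hmem : Memℓp (fun α : ι →₀ ℕ => √(GaussianChaos.weight q r α) • η α) 2 :=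
      memℓp_gen (by simpa only [ENNReal.toReal_ofNat, Real.rpow_ofNat] using hs)
    obtain ⟨x, hx⟩ := GaussianChaos.LSpace.surjective_coeffs (u := u) (r := r) hW hq0 ⟨_, hmem⟩
    exact ⟨x, fun α => by rw [hx]⟩
  · rw [← GaussianChaos.LSpace.norm_coeffs hW hq0, GaussianChaos.Simple.norm_sq_eq_tsum]
    simp only [hx]
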